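/- **Setting.** Let $T>0$, let $U\subset\mathbb{R}^c$ be compact and convex, and let $\mathcal{U}=L^2([0,T],U)$. Let $\mathcal{P}_c(\mathbb{R}^d)$ be the set of Borel probability measures on $\mathbb{R}^d$ with compact support, $W_2$ the $2$-Wasserstein distance, and $m_\infty(\mu)=\sup\{\|x\| : x\in\mathrm{supp}\,\mu\}$. Let $F[\mu](x,y)\in\mathbb{R}^d$ and $G[\mu](y)\in\mathbb{R}^c$ be defined for $\mu\in\mathcal{P}_c(\mathbb{R}^d)$, $x\in\mathbb{R}^d$, $y\in\mathbb{R}^c$, and put $\mathfrak{d}((\mu_1,y_1),(\mu_2,y_2))=W_2(\mu_1,\mu_2)+\|y_1-y_2\|$. Assume: (LIP) there is $\mathbf{L}>0$ such that for all $\mu_1,\mu_2\in\mathcal{P}_c(\mathbb{R}^d)$, $x_1,x_2\in\mathbb{R}^d$, $y_1,y_2\in\mathbb{R}^c$, $$\|F[\mu_1](x_1,y_1)-F[\mu_2](x_2,y_2)\|\le \mathbf{L}\bigl(\|x_1-x_2\|+\mathfrak{d}((\mu_1,y_1),(\mu_2,y_2))\bigr),\qquad \|G[\mu_1](y_1)-G[\mu_2](y_2)\|\le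 \mathbf{L}\,\mathfrak{d}((\mu_1,y_1),(\mu_2,y_2));$$ (SLG) there is $\mathbf{C}>0$ such that for all $\mu\in\mathcal{P}_c(\mathbb{R}^d)$, $x\in\mathbb{R}^d$, $y\in\mathbb{R}^c$, $$\|F[\mu](x,y)\|\le \mathbf{C}(1+\|x\|+\|y\|+m_\infty(\mu)),\qquad \|G[\mu](y)\|\le \mathbf{C}(1+\|y\|+m_\infty(\mu)).$$ For $\mathbf{u}\in\mathcal{U}$ consider the system $$\partial_t\mu(t)+\nabla_x\cdot\bigl(F[\mu(t)](\cdot,y(t))\,\mu(t)\bigr)=0,\qquad \dot y(t)=G[\mu(t)](y(t))+\mathbf{u}(t).$$ A solution of the Cauchy problem with data $(t_0,\mu_0,y_0,\mathbf{u})$ is a pair $(\boldsymbol\mu,\mathbf{y}):[0,T]\to\mathcal{P}_c(\mathbb{R}^d)\times\mathbb{R}^c$ with $\boldsymbol\mu(t_0)=\mu_0$, $\mathbf{y}(t_0)=y_0$ such that $t\mapsto\boldsymbol\mu(t)$ is continuous with respect to $W_2$; there is $r>0$ with $\mathrm{supp}\,\boldsymbol\mu(t)\subset B(0,r)$ for all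 $t\in[0,T]$; for every $\varphi\in C_c^\infty((0,T)\times\mathbb{R}^d)$, $$\int_0^T\int_{\mathbb{R}^d}\bigl(\partial_t\varphi(t,x)+\nabla_x\varphi(t,x)\cdot F[\boldsymbol\mu(t)](x,\mathbf{y}(t))\bigr)\,d(\boldsymbol\mu(t))(x)\,dt=0;$$ and $\mathbf{y}$ is absolutely continuous on $[0,T]$ with $\dot{\mathbf{y}}(t)=G[\boldsymbol\mu(t)](\mathbf{y}(t))+\mathbf{u}(t)$ for a.e. $t\in[0,T]$. **Theorem (Well-posedness and flow representation).** For every $\mathbf{u}\in\mathcal{U}$, $t_0\in[0,T]$, $\mu_0\in\mathcal{P}_c(\mathbb{R}^d)$ and $y_0\in\mathbb{R}^c$, the Cauchy problem with data $(t_0,\mu_0,y_0,\mathbf{u})$ has a unique solution $(\boldsymbol\mu,\mathbf{y})$ on $[0,T]$. Moreover: (i) *A priori bounds.* For every $R>0$ there is $\bar R>0$, depending only on $R$, $U$, $\mathbf{C}$ and $T$, such that if $m_\infty(\mu_0)\le R$ and $\|y_0\|\le R$, then $m_\infty(\boldsymbol\mu(t))\le\bar R$ and $\|\mathbf{y}(t)\|\le\bar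 R$ for every $\mathbf{u}\in\mathcal{U}$, $t_0\in[0,T]$ and $t\in[0,T]$. (ii) *Lagrangian representation.* There is a flow $\mathbf\Phi:[0,T]\times\mathbb{R}^d\to\mathbb{R}^d$, with $\mathbf\Phi(t,\cdot)$ Borel measurable, such that for all $x\in\mathbb{R}^d$ and $t\in[0,T]$, $$\mathbf\Phi(t_0,x)=x,\qquad \frac{d}{dt}\mathbf\Phi(t,x)=F[\boldsymbol\mu(t)]\bigl(\mathbf\Phi(t,x),\mathbf{y}(t)\bigr)$$ (one-sided derivatives at $t=0$ and $t=T$), and $\boldsymbol\mu(t)=\mathbf\Phi(t,\cdot)_\#\mu_0$ for every $t\in[0,T]$. In particular, if $\mu_0$ is absolutely continuous with respect to the Lebesgue measure, then so is $\boldsymbol\mu(t)$ for every $t\in[0,T]$. -/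

import Mathlib

open MeasureTheory Set Filter
open scoped Topology ENNReal ContDiff

namespace SparseMeanField

/-- The Euclidean space `ℝⁿ`. -/
abbrev E (n : ℕ) : Type := EuclideanSpace ℝ (Fin n)

/-- `𝒫_c(ℝⁿ)`: Borel probability measures on `ℝⁿ` with compact support. -/
def Pc (n : ℕ) : Type :=
  {μ : ProbabilityMeasure (E n) // IsCompact (μ : Measure (E n)).support}

/-- The underlying measure of an element of `𝒫_c(ℝⁿ)`. -/
def Pc.meas {n : ℕ} (μ : Pc n) : Measure (E n) := (μ.1 : Measure (E n))

/-- The radius of the support, `m_∞(μ) = sup {‖x‖ : x ∈ supp μ}`. -/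
noncomputable def mInf {n : ℕ} (μ : Pc n) : ℝ :=
  sSup ((fun x : E n => ‖x‖) '' μ.meas.support)

/-- The couplings `Γ(μ, ν)`: probability measures on `ℝⁿ × ℝⁿ` with marginals `μ` and `ν`. -/
def couplings {n : ℕ} (μ ν : Pc n) : Set (ProbabilityMeasure (E n × E n)) :=
  {γ | (γ : Measure (E n × E n)).map Prod.fst = μ.meas ∧
       (γ : Measure (E n × E n)).map Prod.snd = ν.meas}

/-- The 2-Wasserstein distance,
`W₂(μ, ν) = inf_{γ ∈ Γ(μ, ν)} (∫ ‖x - y‖² dγ(x, y))^{1/2}`. The infimum is taken in `[0, ∞]`; it is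
finite for compactly supported measures. -/
noncomputable def W2 {n : ℕ} (μ ν : Pc n) : ℝ :=
  (⨅ γ ∈ couplings μ ν,
    (∫⁻ p, ‖p.1 - p.2‖ₑ ^ 2 ∂(γ : Measure (E n × E n))) ^ (1 / 2 : ℝ)).toReal

/-- The product metric `𝔡((μ₁, y₁), (μ₂, y₂)) = W₂(μ₁, μ₂) + ‖y₁ - y₂‖`. -/
noncomputable def dist𝔡 {d c : ℕ} (μ₁ : Pc d) (y₁ : E c) (μ₂ : Pc d) (y₂ : E c) : ℝ :=
  W2 μ₁ μ₂ + ‖y₁ - y₂‖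

/-- Lipschitz continuity of the pair of non-local vector fields `F[μ](x, y)` and `G[μ](y)`. -/
def LIP {d c : ℕ} (F : Pc d → E d → E c → E d) (G : Pc d → E c → E c) : Prop :=
  ∃ L : ℝ, 0 < L ∧ ∀ (μ₁ μ₂ : Pc d) (y₁ y₂ : E c),
    (∀ x₁ x₂ : E d, ‖F μ₁ x₁ y₁ - F μ₂ x₂ y₂‖ ≤ L * (‖x₁ - x₂‖ + dist𝔡 μ₁ y₁ μ₂ y₂)) ∧
    ‖G μ₁ y₁ - G μ₂ y₂‖ ≤ L * dist𝔡 μ₁ y₁ μ₂ y₂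

/-- Sublinear growth of `F` and `G` with constant `C`. -/
def SLG {d c : ℕ} (C : ℝ) (F : Pc d → E d → E c → E d) (G : Pc d → E c → E c) : Prop :=
  ∀ (μ : Pc d) (y : E c),
    (∀ x : E d, ‖F μ x y‖ ≤ C * (1 + ‖x‖ + ‖y‖ + mInf μ)) ∧
    ‖G μ y‖ ≤ C * (1 + ‖y‖ + mInf μ)

/-- The admissible controls `𝒰 = L²([0, T], U)`. -/
def IsControl {c : ℕ} (T : ℝ) (U : Set (E c)) (u : ℝ → E c) : Prop :=
  MemLp u 2 (volume.restrict (Icc 0 T)) ∧ ∀ᵐ t ∂(volume.restrict (Icc 0 T)), u t ∈ U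

/-- Continuity on `[0, T]` of a curve with values in `(𝒫_c(ℝⁿ), W₂)`. -/
def IsContinuousCurve {n : ℕ} (T : ℝ) (μ : ℝ → Pc n) : Prop :=
  ∀ s ∈ Icc 0 T, Tendsto (fun t => W2 (μ t) (μ s)) (𝓝[Icc 0 T] s) (𝓝 0)

/-- The class `C_c^∞((0, T) × ℝⁿ)` of test functions. -/
def IsTestFunction {n : ℕ} (T : ℝ) (φ : ℝ × E n → ℝ) : Prop :=
  ContDiff ℝ ∞ φ ∧ HasCompactSupport φ ∧ tsupport φ ⊆ Ioo 0 T ×ˢ univ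

/-- The weak form of `∂ₜμ + ∇ₓ · (F[μ(t)](·, y(t)) μ(t)) = 0` on `(0, T) × ℝᵈ`. -/
def WeakContinuityEquation {d c : ℕ} (T : ℝ) (F : Pc d → E d → E c → E d)
    (μ : ℝ → Pc d) (y : ℝ → E c) : Prop :=
  ∀ φ : ℝ × E d → ℝ, IsTestFunction T φ →
    ∫ t in (0 : ℝ)..T, ∫ x, (deriv (fun s => φ (s, x)) t +
      inner ℝ (gradient (fun z => φ (t, z)) x) (F (μ t) x (y t))) ∂((μ t).meas) = 0

/-- `y` is a Carathéodory solution on `[0, T]` of `ẏ(t) = G[μ(t)](y(t)) + u(t)`. -/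
def IsCaratheodorySolution {d c : ℕ} (T : ℝ) (G : Pc d → E c → E c) (u : ℝ → E c)
    (μ : ℝ → Pc d) (y : ℝ → E c) : Prop :=
  AbsolutelyContinuousOnInterval y 0 T ∧
  ∀ᵐ t ∂(volume.restrict (Icc 0 T)), HasDerivAt y (G (μ t) (y t) + u t) t

/-- Weak measure solutions on `[0, T]` of the coupled system with control `u`. The curves are
functions on `ℝ`, of which only the values on `[0, T]` matter. -/
structure IsWeakSolution {d c : ℕ} (T : ℝ) (F : Pc d → E d → E c → E d) (G : Pc d → E c → E c)
    (u : ℝ → E c) (μ : ℝ → Pc d) (y : ℝ → E c) : Prop where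
  continuous : IsContinuousCurve T μ
  equicompact : ∃ R : ℝ, 0 < R ∧ ∀ t ∈ Icc 0 T, (μ t).meas.support ⊆ Metric.ball 0 R
  continuityEquation : WeakContinuityEquation T F μ y
  caratheodory : IsCaratheodorySolution T G u μ y

/-- Solutions of the Cauchy problem with data `(t₀, μ₀, y₀, u)`. -/
structure IsCauchySolution {d c : ℕ} (T : ℝ) (F : Pc d → E d → E c → E d)
    (G : Pc d → E c → E c) (t₀ : ℝ) (μ₀ : Pc d) (y₀ : E c) (u : ℝ → E c)
    (μ : ℝ → Pc d) (y : ℝ → E c) : Prop where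
  weakSolution : IsWeakSolution T F G u μ y
  initial_measure : μ t₀ = μ₀
  initial_state : y t₀ = y₀

/-- `Φ` is a flow on `[0, T]` of the characteristics of `F` along `(μ, y)`, starting at time `t₀`;
at the end points of `[0, T]` the time derivative is one-sided. -/
structure IsFlow {d c : ℕ} (T : ℝ) (F : Pc d → E d → E c → E d) (t₀ : ℝ)
    (μ : ℝ → Pc d) (y : ℝ → E c) (Φ : ℝ → E d → E d) : Prop where
  initial : ∀ x, Φ t₀ x = x
  ode : ∀ x, ∀ t ∈ Icc 0 T,
    HasDerivWithinAt (fun s => Φ s x) (F (μ t) (Φ t x) (y t)) (Icc 0 T) t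

end SparseMeanField

namespace SparseMeanField

/-! ### Ordinary differential equations in Banach spaces -/

section ODE

variable {X : Type*} [NormedAddCommGroup X] [NormedSpace ℝ X]

/-! The system becomes an ordinary differential equation once masses are labelled by their initial
positions. Let `Ω = supp μ₀`, with `μ₀` as a probability measure on it. A measure curve is replaced
by a curve `γ` in `C(Ω, ℝᵈ)`, with `μ(t)` the push-forward of `μ₀` by `γ(t)`. Subtracting from `y`
the primitive `w` of the control leaves a field on the Banach space `C(Ω, ℝᵈ) × ℝᶜ` that is
continuous in time, although `u` is only measurable. The field is globally Lipschitz, because two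
push-forwards of the same measure satisfy `W₂ ≤ ‖γ₁ - γ₂‖` (`W2_push_le`). Hence `ode_exists` and
`ode_unique` give exactly one Lagrangian solution on `[0, T]`, in both time directions from `t₀`.

Uniqueness among weak solutions reduces to this (`exists_lagrangian_of_isCauchySolution`). Freeze
the field `v(t, x) = F[μ(t)](x, y(t))` along a given solution. Both `μ` and the push-forward of `μ₀`
along the characteristics of `v` solve the same linear continuity equation with the same value at
`t₀`. They agree by `TransportIdentity.unique`, so the given solution is Lagrangian.

Linear uniqueness is proved by duality without differentiating the flow of `v`, which is only
Lipschitz in space. A smooth function with gradient at most one is carried back over a short time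
along straight lines directed by a mollification of `v(s, ·)`. This bounds the growth of the dual
Lipschitz distance of two solutions to first order (`dualDist_step`), and a local Grönwall argument
keeps it at zero.

The a priori bound is Grönwall's inequality in the sup norm, which dominates `m_∞` of the
push-forward. The flow on all of `ℝᵈ` comes from the frozen field; it expands no distance ratio to
zero, so preimages of null sets are null and absolute continuity is preserved. -/

lemma abs_integral_exp_abs_le {lam : ℝ} (hlam : 0 < lam) (a t : ℝ) :
    |∫ s in a..t, Real.exp (lam * |s - a|)| ≤ Real.exp (lam * |t - a|) / lam := by
  rcases le_total a t with h | h
  · have h1 : ∫ s in a..t, Real.exp (lam * |s - a|) = ∫ s in a..t, Real.exp (lam * (s - a)) := by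
      refine intervalIntegral.integral_congr fun s hs => ?_
      rw [uIcc_of_le h] at hs
      simp only [abs_of_nonneg (sub_nonneg.2 hs.1)]
    have h2 : ∫ s in a..t, Real.exp (lam * (s - a)) =
        Real.exp (lam * (t - a)) / lam - Real.exp (lam * (a - a)) / lam := by
      refine intervalIntegral.integral_eq_sub_of_hasDerivAt
        (f := fun s => Real.exp (lam * (s - a)) / lam) (fun s _ => ?_)
        (Continuous.intervalIntegrable (by fun_prop) _ _)
      have := (((hasDerivAt_id s).sub_const a).const_mul lam).exp.div_const lam
      convert! this using 1
      simp only [id]; field_simp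
    have h4 : (1 : ℝ) ≤ Real.exp (lam * (t - a)) := Real.one_le_exp (by
      have := sub_nonneg.2 h; positivity)
    rw [h1, h2, abs_of_nonneg (sub_nonneg.2 h), sub_self, mul_zero, Real.exp_zero, ← sub_div,
      abs_of_nonneg (div_nonneg (by linarith) hlam.le)]
    gcongr
    linarith
  · have h1 : ∫ s in a..t, Real.exp (lam * |s - a|) = ∫ s in a..t, Real.exp (lam * (a - s)) := by
      refine intervalIntegral.integral_congr fun s hs => ?_
      rw [uIcc_of_ge h] at hs
      simp only [abs_of_nonpos (sub_nonpos.2 hs.2), neg_sub]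
    have h2 : ∫ s in a..t, Real.exp (lam * (a - s)) =
        -Real.exp (lam * (a - t)) / lam - -Real.exp (lam * (a - a)) / lam := by
      refine intervalIntegral.integral_eq_sub_of_hasDerivAt
        (f := fun s => -Real.exp (lam * (a - s)) / lam) (fun s _ => ?_)
        (Continuous.intervalIntegrable (by fun_prop) _ _)
      have := (((hasDerivAt_id s).const_sub a).const_mul lam).exp.neg.div_const lam
      convert! this using 1
      simp only [id]; field_simp
    have h4 : (1 : ℝ) ≤ Real.exp (lam * (a - t)) := Real.one_le_exp (by
      have := sub_nonneg.2 h; positivity)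
    rw [h1, h2, abs_of_nonpos (sub_nonpos.2 h), neg_sub, sub_self, mul_zero, Real.exp_zero,
      ← sub_div, abs_of_nonpos (div_nonpos_of_nonpos_of_nonneg (by linarith) hlam.le), ← neg_div]
    gcongr
    linarith

/-- Two-sided Grönwall inequality for curves in a normed space. -/
lemma norm_le_gronwallBound_two_sided {T : ℝ} {α α' : ℝ → X} {δ K ε : ℝ}
    (hα : ∀ t ∈ Icc 0 T, HasDerivWithinAt α (α' t) (Icc 0 T) t) {t₀ : ℝ} (ht₀ : t₀ ∈ Icc 0 T)
    (h0 : ‖α t₀‖ ≤ δ) (hb : ∀ t ∈ Icc 0 T, ‖α' t‖ ≤ K * ‖α t‖ + ε) :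
    ∀ t ∈ Icc 0 T, ‖α t‖ ≤ gronwallBound δ K ε |t - t₀| := by
  have hc : ContinuousOn α (Icc 0 T) := fun t ht => (hα t ht).continuousWithinAt
  intro t ht
  rcases le_total t₀ t with h | h
  · rw [abs_of_nonneg (sub_nonneg.2 h)]
    refine norm_le_gronwallBound_of_norm_deriv_right_le (f' := α') (a := t₀) (b := T)
      (hc.mono (Icc_subset_Icc_left ht₀.1)) (fun x hx => ?_) h0
      (fun x hx => hb x ⟨ht₀.1.trans hx.1, hx.2.le⟩) t ⟨h, ht.2⟩
    have hx' : x ∈ Icc 0 T := ⟨ht₀.1.trans hx.1, hx.2.le⟩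
    refine (hα x hx').mono_of_mem_nhdsWithin ?_
    exact mem_of_superset (Icc_mem_nhdsGE hx.2) (Icc_subset_Icc_left hx'.1)
  · rw [abs_of_nonpos (sub_nonpos.2 h)]
    -- Times before `t₀` are reached by reversing time, which turns the left derivative into a right
    -- derivative.
    have key := norm_le_gronwallBound_of_norm_deriv_right_le (f := fun s => α (-s))
      (f' := fun s => -α' (-s)) (δ := δ) (K := K) (ε := ε) (a := -t₀) (b := 0)
      (hc.comp continuous_neg.continuousOn fun s hs =>
        ⟨by linarith [hs.2], by linarith [hs.1, ht₀.2]⟩)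
      (fun x hx => ?_) (by simpa using h0)
      (fun x hx => by
        rw [norm_neg]; exact hb _ ⟨by linarith [hx.2], by linarith [hx.1, ht₀.2]⟩)
      (-t) ⟨by linarith, by linarith [ht.1]⟩
    · simpa [sub_eq_add_neg, add_comm] using key
    · have hx' : -x ∈ Icc 0 T := ⟨by linarith [hx.2], by linarith [hx.1, ht₀.2]⟩
      have h1 : HasDerivWithinAt α (α' (-x)) (Iic (-x)) (-x) :=
        (hα _ hx').mono_of_mem_nhdsWithin
          (mem_of_superset (Icc_mem_nhdsLE (by linarith [hx.2])) (Icc_subset_Icc_right hx'.2))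
      have h2 := HasDerivWithinAt.scomp (t' := Iic (-x)) (s := Ici x) x h1
        ((hasDerivAt_neg x).hasDerivWithinAt) (fun s hs => by
          simpa using hs)
      simpa [Function.comp_def] using h2

/-- Lipschitz dependence on the value at one time, in both time directions. -/
lemma ode_dist_le {T L : ℝ} {f : ℝ → X → X}
    (hlip : ∀ t ∈ Icc 0 T, ∀ x y, ‖f t x - f t y‖ ≤ L * ‖x - y‖) {α β : ℝ → X}
    (hα : ∀ t ∈ Icc 0 T, HasDerivWithinAt α (f t (α t)) (Icc 0 T) t)
    (hβ : ∀ t ∈ Icc 0 T, HasDerivWithinAt β (f t (β t)) (Icc 0 T) t)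
    {t₀ : ℝ} (ht₀ : t₀ ∈ Icc 0 T) :
    ∀ t ∈ Icc 0 T, ‖α t - β t‖ ≤ ‖α t₀ - β t₀‖ * Real.exp (L * |t - t₀|) := by
  intro t ht
  rw [← gronwallBound_ε0]
  exact norm_le_gronwallBound_two_sided (α := fun t => α t - β t)
    (fun t ht => (hα t ht).sub (hβ t ht)) ht₀ le_rfl
    (fun t ht => by simpa using hlip t ht _ _) t ht

lemma ode_unique {T L : ℝ} {f : ℝ → X → X}
    (hlip : ∀ t ∈ Icc 0 T, ∀ x y, ‖f t x - f t y‖ ≤ L * ‖x - y‖) {α β : ℝ → X}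
    (hα : ∀ t ∈ Icc 0 T, HasDerivWithinAt α (f t (α t)) (Icc 0 T) t)
    (hβ : ∀ t ∈ Icc 0 T, HasDerivWithinAt β (f t (β t)) (Icc 0 T) t)
    {t₀ : ℝ} (ht₀ : t₀ ∈ Icc 0 T) (h0 : α t₀ = β t₀) :
    ∀ t ∈ Icc 0 T, α t = β t := by
  intro t ht
  have := ode_dist_le hlip hα hβ ht₀ t ht
  rw [h0, sub_self, norm_zero, zero_mul] at this
  exact sub_eq_zero.1 (norm_le_zero_iff.1 this)

/-- Global existence on `[0, T]` for globally Lipschitz fields. -/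
lemma ode_exists [CompleteSpace X] {T L : ℝ} (hL : 0 < L) {f : ℝ → X → X}
    (hlip : ∀ t ∈ Icc 0 T, ∀ x y, ‖f t x - f t y‖ ≤ L * ‖x - y‖)
    (hcont : ∀ x, ContinuousOn (fun t => f t x) (Icc 0 T))
    {t₀ : ℝ} (ht₀ : t₀ ∈ Icc 0 T) (x₀ : X) :
    ∃ α : ℝ → X, α t₀ = x₀ ∧
      ∀ t ∈ Icc 0 T, HasDerivWithinAt α (f t (α t)) (Icc 0 T) t := by
  have hT : 0 ≤ T := ht₀.1.trans ht₀.2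
  have : Nonempty (Icc 0 T) := ⟨⟨t₀, ht₀⟩⟩
  set f' : ℝ → X → X := fun t x => f (projIcc 0 T hT t) x with hf'
  have hlip' : ∀ t x y, ‖f' t x - f' t y‖ ≤ L * ‖x - y‖ := fun t x y =>
    hlip _ (projIcc 0 T hT t).2 x y
  have hf'c : Continuous (Function.uncurry f') := by
    refine continuous_prod_of_continuous_lipschitzWith' (Function.uncurry f') L.toNNReal
      (fun t => ?_) (fun x => ?_)
    · refine LipschitzWith.of_dist_le_mul fun x y => ?_
      rw [dist_eq_norm, dist_eq_norm, Real.coe_toNNReal _ hL.le]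
      exact hlip' t x y
    · exact (continuousOn_iff_continuous_domRestrict.1 (hcont x)).comp continuous_projIcc
  -- Bielecki weight: the unknown is `Y = w⁻¹ • α`, so the sup norm of `Y` is a weighted norm of
  -- `α`. The exponent `2 * L` makes the Picard map a contraction of ratio `L / (2 * L) = 1 / 2`
  -- whatever the length of the interval.
  set w : ℝ → ℝ := fun s => Real.exp (2 * L * |s - t₀|) with hw
  have hwc : Continuous w := by fun_prop
  have hwpos : ∀ s, 0 < w s := fun s => Real.exp_pos _
  let b : C(Icc 0 T, X) → ℝ → X := fun Y s => w s • Y (projIcc 0 T hT s)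
  have hb : ∀ Y, Continuous (b Y) := fun Y =>
    hwc.smul (Y.continuous.comp continuous_projIcc)
  have hg : ∀ Y, Continuous (fun s => f' s (b Y s)) := fun Y =>
    hf'c.comp (continuous_id.prodMk (hb Y))
  let a : C(Icc 0 T, X) → ℝ → X := fun Y t => x₀ + ∫ s in t₀..t, f' s (b Y s)
  have ha : ∀ Y t, HasDerivAt (a Y) (f' t (b Y t)) t := fun Y t =>
    (intervalIntegral.integral_hasDerivAt_right ((hg Y).intervalIntegrable _ _)
      ((hg Y).stronglyMeasurableAtFilter _ _) (hg Y).continuousAt).const_add x₀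
  have hac : ∀ Y, Continuous (a Y) := fun Y =>
    continuous_iff_continuousAt.2 fun t => (ha Y t).continuousAt
  let P : C(Icc 0 T, X) → C(Icc 0 T, X) := fun Y =>
    ⟨fun t => (w t)⁻¹ • a Y t, ((hwc.inv₀ fun s => (hwpos s).ne').smul (hac Y)).comp
      continuous_subtype_val⟩
  have hP : ContractingWith (1 / 2) P := by
    refine ⟨by norm_num, LipschitzWith.of_dist_le_mul fun Y Z => ?_⟩
    rw [ContinuousMap.dist_le (by positivity)]
    intro t
    have h1 : P Y t - P Z t = (w t)⁻¹ • ∫ s in t₀..t, (f' s (b Y s) - f' s (b Z s)) := by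
      rw [intervalIntegral.integral_sub ((hg Y).intervalIntegrable _ _)
        ((hg Z).intervalIntegrable _ _)]
      simp only [P, a, ContinuousMap.coe_mk, ← smul_sub]
      congr 1
      abel
    have h2 : ∀ s, ‖f' s (b Y s) - f' s (b Z s)‖ ≤ (L * dist Y Z) * w s := by
      intro s
      refine (hlip' s _ _).trans ?_
      have : b Y s - b Z s = w s • (Y (projIcc 0 T hT s) - Z (projIcc 0 T hT s)) := by
        simp only [b, smul_sub]
      rw [this, norm_smul, Real.norm_of_nonneg (hwpos s).le, ← dist_eq_norm]
      have := ContinuousMap.dist_apply_le_dist (f := Y) (g := Z) (projIcc 0 T hT s)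
      have := (hwpos s).le
      calc L * (w s * dist (Y (projIcc 0 T hT s)) (Z (projIcc 0 T hT s)))
          ≤ L * (w s * dist Y Z) := by gcongr
        _ = _ := by ring
    have h3 : ‖∫ s in t₀..t, (f' s (b Y s) - f' s (b Z s))‖ ≤
        (L * dist Y Z) * (w t / (2 * L)) := by
      refine (intervalIntegral.norm_integral_le_abs_of_norm_le
        (Eventually.of_forall fun s => h2 s)
        ((hwc.const_mul _).intervalIntegrable _ _)).trans ?_
      rw [intervalIntegral.integral_const_mul, abs_mul, abs_of_nonneg (by positivity)]
      gcongr
      exact abs_integral_exp_abs_le (by positivity) t₀ t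
    rw [dist_eq_norm, h1, norm_smul, norm_inv, Real.norm_of_nonneg (hwpos _).le]
    refine (mul_le_mul_of_nonneg_left h3 (inv_nonneg.2 (hwpos _).le)).trans (le_of_eq ?_)
    have := (hwpos t).ne'
    push_cast
    field_simp
  obtain ⟨Y, hY⟩ : ∃ Y, P Y = Y := ⟨hP.fixedPoint, hP.fixedPoint_isFixedPt⟩
  have hba : ∀ t ∈ Icc 0 T, b Y t = a Y t := by
    intro t ht
    have h1 : Y ⟨t, ht⟩ = (w t)⁻¹ • a Y t := by
      conv_lhs => rw [← hY]
      rfl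
    simp only [b, projIcc_of_mem hT ht, h1, smul_inv_smul₀ (hwpos t).ne']
  refine ⟨a Y, by simp [a], fun t ht => ?_⟩
  have := (ha Y t).hasDerivWithinAt (s := Icc 0 T)
  simpa only [hba t ht, hf', projIcc_of_mem hT ht] using this

end ODE

/-! ### Couplings and the Wasserstein distance -/

section Wasserstein

variable {n : ℕ}

instance (μ : Pc n) : IsProbabilityMeasure μ.meas := by
  unfold Pc.meas; infer_instance

lemma Pc.ext_meas {μ ν : Pc n} (h : μ.meas = ν.meas) : μ = ν :=
  Subtype.ext (Subtype.ext h)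

lemma Pc.ae_mem_support (μ : Pc n) : ∀ᵐ x ∂μ.meas, x ∈ μ.meas.support :=
  Measure.support_mem_ae

lemma Pc.isCompact_support (μ : Pc n) : IsCompact μ.meas.support := μ.2

lemma Pc.integrable (μ : Pc n) {F : Type*} [NormedAddCommGroup F] {f : E n → F}
    (hf : Continuous f) : Integrable f μ.meas := by
  have h := hf.continuousOn.integrableOn_compact (μ := μ.meas) μ.isCompact_support
  rwa [IntegrableOn, Measure.restrict_eq_self_of_ae_mem μ.ae_mem_support] at h

lemma couplings_ae_fst {μ ν : Pc n} {γ : ProbabilityMeasure (E n × E n)} (hγ : γ ∈ couplings μ ν)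
    {p : E n → Prop} (h : ∀ᵐ x ∂μ.meas, p x) :
    ∀ᵐ z ∂(γ : Measure (E n × E n)), p z.1 := by
  rw [← hγ.1] at h
  exact ae_of_ae_map measurable_fst.aemeasurable h

lemma couplings_ae_snd {μ ν : Pc n} {γ : ProbabilityMeasure (E n × E n)} (hγ : γ ∈ couplings μ ν)
    {p : E n → Prop} (h : ∀ᵐ x ∂ν.meas, p x) :
    ∀ᵐ z ∂(γ : Measure (E n × E n)), p z.2 := by
  rw [← hγ.2] at h
  exact ae_of_ae_map measurable_snd.aemeasurable h

/-- The `L²` cost of a coupling of compactly supported measures is finite. -/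
lemma couplings_cost_lt_top {μ ν : Pc n} {γ : ProbabilityMeasure (E n × E n)}
    (hγ : γ ∈ couplings μ ν) :
    ∫⁻ p, ‖p.1 - p.2‖ₑ ^ 2 ∂(γ : Measure (E n × E n)) < ⊤ := by
  obtain ⟨r, hr⟩ := μ.isCompact_support.isBounded.exists_norm_le
  obtain ⟨r', hr'⟩ := ν.isCompact_support.isBounded.exists_norm_le
  have h : ∀ᵐ p ∂(γ : Measure (E n × E n)), ‖p.1 - p.2‖ₑ ^ 2 ≤ ENNReal.ofReal (r + r') ^ 2 := by
    filter_upwards [couplings_ae_fst hγ μ.ae_mem_support, couplings_ae_snd hγ ν.ae_mem_support]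
      with p h1 h2
    gcongr
    rw [← ofReal_norm]
    exact ENNReal.ofReal_le_ofReal
      ((norm_sub_le _ _).trans (add_le_add (hr _ h1) (hr' _ h2)))
  refine (lintegral_mono_ae h).trans_lt ?_
  simp

lemma couplings_nonempty (μ ν : Pc n) : (couplings μ ν).Nonempty :=
  ⟨⟨μ.meas.prod ν.meas, inferInstance⟩, by
    constructor
    · exact (Measure.map_fst_prod).trans (by simp)
    · exact (Measure.map_snd_prod).trans (by simp)⟩

lemma W2_le_of_coupling {μ ν : Pc n} {γ : ProbabilityMeasure (E n × E n)} (hγ : γ ∈ couplings μ ν)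
    {r : ℝ} (hr : 0 ≤ r) (h : ∀ᵐ p ∂(γ : Measure (E n × E n)), ‖p.1 - p.2‖ ≤ r) :
    W2 μ ν ≤ r := by
  refine ENNReal.toReal_le_of_le_ofReal hr ((iInf₂_le γ hγ).trans ?_)
  have h1 : ∫⁻ p, ‖p.1 - p.2‖ₑ ^ 2 ∂(γ : Measure (E n × E n)) ≤ ENNReal.ofReal r ^ 2 := by
    have h2 : ∀ᵐ p ∂(γ : Measure (E n × E n)), ‖p.1 - p.2‖ₑ ^ 2 ≤ ENNReal.ofReal r ^ 2 := by
      filter_upwards [h] with p hp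
      gcongr
      rw [← ofReal_norm]
      exact ENNReal.ofReal_le_ofReal hp
    refine (lintegral_mono_ae h2).trans ?_
    simp
  calc (∫⁻ p, ‖p.1 - p.2‖ₑ ^ 2 ∂(γ : Measure (E n × E n))) ^ (1 / 2 : ℝ)
      ≤ (ENNReal.ofReal r ^ 2) ^ (1 / 2 : ℝ) := by gcongr
    _ = ENNReal.ofReal r := by
      rw [← ENNReal.rpow_natCast, ← ENNReal.rpow_mul]; norm_num

lemma W2_nonneg (μ ν : Pc n) : 0 ≤ W2 μ ν := ENNReal.toReal_nonneg

/-- Almost optimal couplings suffice below, so attainment of the infimum is not needed. -/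
lemma exists_coupling_of_W2_lt {μ ν : Pc n} {η : ℝ} (h : W2 μ ν < η) :
    ∃ γ ∈ couplings μ ν, ∫ p, ‖p.1 - p.2‖ ^ 2 ∂(γ : Measure (E n × E n)) ≤ η ^ 2 ∧
      Integrable (fun p : E n × E n => ‖p.1 - p.2‖ ^ 2) (γ : Measure (E n × E n)) := by
  have hη : 0 < η := (W2_nonneg μ ν).trans_lt h
  -- Finiteness is essential: `toReal` would send an infinite infimum to `0`.
  have hfin : (⨅ γ ∈ couplings μ ν,
      (∫⁻ p, ‖p.1 - p.2‖ₑ ^ 2 ∂(γ : Measure (E n × E n))) ^ (1 / 2 : ℝ)) ≠ ⊤ := by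
    obtain ⟨γ, hγ⟩ := couplings_nonempty μ ν
    exact ((iInf₂_le γ hγ).trans_lt
      (ENNReal.rpow_lt_top_of_nonneg (by norm_num) (couplings_cost_lt_top hγ).ne)).ne
  have h1 := (ENNReal.lt_ofReal_iff_toReal_lt hfin).2 h
  simp only [iInf_lt_iff] at h1
  obtain ⟨γ, hγ, h2⟩ := h1
  have hcost := couplings_cost_lt_top hγ
  have h3 : ∫⁻ p, ‖p.1 - p.2‖ₑ ^ 2 ∂(γ : Measure (E n × E n)) ≤ ENNReal.ofReal (η ^ 2) := by
    have h4 := ENNReal.rpow_le_rpow h2.le (z := 2) (by norm_num)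
    rw [← ENNReal.rpow_mul] at h4
    rw [ENNReal.ofReal_pow hη.le]
    norm_num at h4
    exact h4
  have hm : AEStronglyMeasurable (fun p : E n × E n => ‖p.1 - p.2‖ ^ 2)
      (γ : Measure (E n × E n)) := by
    have : Continuous (fun p : E n × E n => ‖p.1 - p.2‖ ^ 2) := by fun_prop
    exact this.aestronglyMeasurable
  have he : ∀ p : E n × E n, ENNReal.ofReal (‖p.1 - p.2‖ ^ 2) = ‖p.1 - p.2‖ₑ ^ 2 := fun p => by
    rw [ENNReal.ofReal_pow (norm_nonneg _), ofReal_norm]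
  refine ⟨γ, hγ, ?_, hm, ?_⟩
  · rw [integral_eq_lintegral_of_nonneg_ae (Eventually.of_forall fun p => by positivity) hm]
    refine ENNReal.toReal_le_of_le_ofReal (by positivity) ?_
    simpa only [he] using h3
  · rw [hasFiniteIntegral_iff_ofReal (Eventually.of_forall fun p => by positivity)]
    simpa only [he] using hcost

lemma W2_self (μ : Pc n) : W2 μ μ = 0 := by
  refine le_antisymm ?_ (W2_nonneg _ _)
  have hm : Measurable fun x : E n => (x, x) := by fun_prop
  refine W2_le_of_coupling (γ := ⟨μ.meas.map fun x => (x, x),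
    Measure.isProbabilityMeasure_map hm.aemeasurable⟩) ⟨?_, ?_⟩ le_rfl ?_
  · simp only [ProbabilityMeasure.coe_mk, Measure.map_map measurable_fst hm]
    exact Measure.map_id
  · simp only [ProbabilityMeasure.coe_mk, Measure.map_map measurable_snd hm]
    exact Measure.map_id
  · simp only [ProbabilityMeasure.coe_mk]
    rw [ae_map_iff hm.aemeasurable (measurableSet_le (by fun_prop) (by fun_prop))]
    simp

/-- Integrals of a continuous function of `(t, x)` along a `W₂`-continuous curve of measures with
uniformly bounded supports depend continuously on time. -/
lemma continuousOn_integral_curve {T R : ℝ} {μ : ℝ → Pc n} (hμ : IsContinuousCurve T μ)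
    (hR : ∀ t ∈ Icc 0 T, (μ t).meas.support ⊆ Metric.ball 0 R) {f : ℝ × E n → ℝ}
    (hf : ContinuousOn f (Icc 0 T ×ˢ univ)) :
    ContinuousOn (fun t => ∫ x, f (t, x) ∂(μ t).meas) (Icc 0 T) := by
  have hS : IsCompact (Icc 0 T ×ˢ Metric.closedBall (0 : E n) R) :=
    isCompact_Icc.prod (isCompact_closedBall _ _)
  have hfS : ContinuousOn f (Icc 0 T ×ˢ Metric.closedBall (0 : E n) R) :=
    hf.mono (prod_mono_right (subset_univ _))
  have huc := hS.uniformContinuousOn_of_continuous hfS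
  obtain ⟨M, hM⟩ := hS.exists_bound_of_continuousOn hfS
  have hcont : ∀ t ∈ Icc 0 T, Continuous fun x => f (t, x) := fun t ht =>
    continuousOn_univ.1 (hf.comp (by fun_prop) fun x _ => ⟨ht, mem_univ _⟩)
  intro s hs
  rw [Metric.continuousWithinAt_iff']
  intro ε hε
  obtain ⟨δ, hδ, hδε⟩ := Metric.uniformContinuousOn_iff.1 huc (ε / 4) (by positivity)
  -- Chosen so that the quadratic term dominates the oscillation `2 * |M|` as soon as `‖x - y‖ ≥ δ`;
  -- for closer points uniform continuity gives `ε / 4`. The resulting pointwise bound integrates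
  -- against a coupling of cost at most `η ^ 2`.
  set C : ℝ := 2 * |M| / δ ^ 2 with hC
  have hC0 : 0 ≤ C := by positivity
  obtain ⟨η, hη, hηε⟩ : ∃ η : ℝ, 0 < η ∧ C * η ^ 2 ≤ ε / 4 := by
    refine ⟨√(ε / 4 / (C + 1)), Real.sqrt_pos.2 (by positivity), ?_⟩
    rw [Real.sq_sqrt (by positivity), mul_div_assoc', div_le_iff₀ (by positivity)]
    nlinarith
  have hpt : ∀ t ∈ Icc 0 T, dist t s < δ → ∀ x ∈ Metric.closedBall (0 : E n) R,
      ∀ y ∈ Metric.closedBall (0 : E n) R, ‖f (t, x) - f (s, y)‖ ≤ ε / 4 + C * ‖x - y‖ ^ 2 := by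
    intro t ht hts x hx y hy
    rcases lt_or_ge (dist x y) δ with hxy | hxy
    · have h1 := hδε (t, x) ⟨ht, hx⟩ (s, y) ⟨hs, hy⟩ (by
        rw [Prod.dist_eq]; exact max_lt hts hxy)
      rw [dist_eq_norm] at h1
      have : 0 ≤ C * ‖x - y‖ ^ 2 := by positivity
      linarith
    · rw [dist_eq_norm] at hxy
      have h1 : 2 * |M| ≤ C * ‖x - y‖ ^ 2 := by
        rw [hC, div_mul_eq_mul_div, le_div_iff₀ (by positivity)]
        gcongr
      have h2 := norm_sub_le (f (t, x)) (f (s, y))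
      have h3 := hM (t, x) ⟨ht, hx⟩
      have h4 := hM (s, y) ⟨hs, hy⟩
      have := le_abs_self M
      linarith
  have hev := (hμ s hs).eventually (gt_mem_nhds hη)
  filter_upwards [hev, self_mem_nhdsWithin,
    mem_nhdsWithin_of_mem_nhds (Metric.ball_mem_nhds s hδ)] with t hW ht hts
  obtain ⟨γ, hγ, hγη, hint⟩ := exists_coupling_of_W2_lt hW
  have e1 : ∫ x, f (t, x) ∂(μ t).meas = ∫ p, f (t, p.1) ∂(γ : Measure (E n × E n)) := by
    rw [← hγ.1, integral_map measurable_fst.aemeasurable (hcont t ht).aestronglyMeasurable]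
  have e2 : ∫ x, f (s, x) ∂(μ s).meas = ∫ p, f (s, p.2) ∂(γ : Measure (E n × E n)) := by
    rw [← hγ.2, integral_map measurable_snd.aemeasurable (hcont s hs).aestronglyMeasurable]
  have i1 : Integrable (fun p => f (t, p.1)) (γ : Measure (E n × E n)) := by
    have := (μ t).integrable (hcont t ht)
    rw [← hγ.1] at this
    exact this.comp_measurable measurable_fst
  have i2 : Integrable (fun p => f (s, p.2)) (γ : Measure (E n × E n)) := by
    have := (μ s).integrable (hcont s hs)
    rw [← hγ.2] at this
    exact this.comp_measurable measurable_snd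
  have hb : ‖∫ p, (f (t, p.1) - f (s, p.2)) ∂(γ : Measure (E n × E n))‖ ≤
      ∫ p, (ε / 4 + C * ‖p.1 - p.2‖ ^ 2) ∂(γ : Measure (E n × E n)) := by
    refine norm_integral_le_of_norm_le ((integrable_const _).add (hint.const_mul C)) ?_
    filter_upwards [couplings_ae_fst hγ (μ t).ae_mem_support,
      couplings_ae_snd hγ (μ s).ae_mem_support] with p h1 h2
    exact hpt t ht hts p.1 (Metric.ball_subset_closedBall (hR t ht h1)) p.2
      (Metric.ball_subset_closedBall (hR s hs h2))
  rw [integral_add (integrable_const _) (hint.const_mul C), integral_const_mul] at hb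
  simp only [integral_const, probReal_univ, smul_eq_mul, one_mul] at hb
  rw [dist_eq_norm, e1, e2, ← integral_sub i1 i2]
  have : C * ∫ p, ‖p.1 - p.2‖ ^ 2 ∂(γ : Measure (E n × E n)) ≤ C * η ^ 2 := by gcongr
  linarith

/-! ### Push-forwards by continuous maps on a compact space -/

section Push

variable {Ω : Type*} [TopologicalSpace Ω] [CompactSpace Ω] [MeasurableSpace Ω] [BorelSpace Ω]

/-- The push-forward of a probability measure on a compact space by a continuous map. -/
noncomputable def push (m : ProbabilityMeasure Ω) (γ : C(Ω, E n)) : Pc n :=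
  ⟨m.map γ.continuous.aemeasurable, by
    refine (isCompact_range γ.continuous).of_isClosed_subset Measure.isClosed_support
      (Measure.support_subset_of_isClosed (isCompact_range γ.continuous).isClosed ?_)
    rw [ProbabilityMeasure.toMeasure_map, mem_ae_map_iff γ.continuous.aemeasurable
      (isCompact_range γ.continuous).measurableSet]
    simp⟩

variable (m : ProbabilityMeasure Ω)

lemma push_meas (γ : C(Ω, E n)) : (push m γ).meas = (m : Measure Ω).map γ := rfl

lemma push_support_subset (γ : C(Ω, E n)) : (push m γ).meas.support ⊆ range γ := by
  refine Measure.support_subset_of_isClosed (isCompact_range γ.continuous).isClosed ?_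
  rw [push_meas, mem_ae_map_iff γ.continuous.aemeasurable
      (isCompact_range γ.continuous).measurableSet]
  simp

/-- The image of `m` under `q ↦ (γ₁ q, γ₂ q)` is a coupling, and it moves no point farther than the
sup distance. -/
lemma W2_push_le (γ₁ γ₂ : C(Ω, E n)) : W2 (push m γ₁) (push m γ₂) ≤ ‖γ₁ - γ₂‖ := by
  have hm : Measurable fun q => (γ₁ q, γ₂ q) :=
    γ₁.continuous.measurable.prodMk γ₂.continuous.measurable
  refine W2_le_of_coupling (γ := m.map hm.aemeasurable) ⟨?_, ?_⟩ (norm_nonneg _) ?_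
  · rw [ProbabilityMeasure.toMeasure_map, Measure.map_map measurable_fst hm]
    rfl
  · rw [ProbabilityMeasure.toMeasure_map, Measure.map_map measurable_snd hm]
    rfl
  · rw [ProbabilityMeasure.toMeasure_map,
      ae_map_iff hm.aemeasurable (measurableSet_le (by fun_prop) (by fun_prop))]
    exact Eventually.of_forall fun q => (γ₁ - γ₂).norm_coe_le_norm q

lemma mInf_push_le (γ : C(Ω, E n)) : mInf (push m γ) ≤ ‖γ‖ := by
  refine Real.sSup_le ?_ (norm_nonneg _)
  rintro _ ⟨x, hx, rfl⟩
  obtain ⟨q, rfl⟩ := push_support_subset m γ hx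
  exact γ.norm_coe_le_norm q

lemma isContinuousCurve_push {T : ℝ} {γ : ℝ → C(Ω, E n)} (hγ : ContinuousOn γ (Icc 0 T)) :
    IsContinuousCurve T fun t => push m (γ t) := by
  intro s hs
  refine squeeze_zero (fun t => W2_nonneg _ _) (fun t => W2_push_le m (γ t) (γ s)) ?_
  have h := ((hγ s hs).sub continuousWithinAt_const (g := fun _ => γ s)).norm
  simpa using h.tendsto

lemma equicompact_push {T : ℝ} {γ : ℝ → C(Ω, E n)} (hγ : ContinuousOn γ (Icc 0 T)) :
    ∃ R : ℝ, 0 < R ∧ ∀ t ∈ Icc 0 T, (push m (γ t)).meas.support ⊆ Metric.ball 0 R := by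
  obtain ⟨R, hR⟩ := isCompact_Icc.exists_bound_of_continuousOn hγ
  refine ⟨|R| + 1, by positivity, fun t ht x hx => ?_⟩
  obtain ⟨q, rfl⟩ := push_support_subset m _ hx
  have := (γ t).norm_coe_le_norm q
  have := hR t ht
  have := le_abs_self R
  rw [mem_ball_zero_iff]
  linarith

end Push

/-! ### A measure as the image of itself on its support -/

section Restrict

/-- `μ` as a probability measure on its own support. -/
noncomputable def suppMeasure (μ : Pc n) : ProbabilityMeasure μ.meas.support :=
  ⟨μ.meas.comap Subtype.val, ⟨by
    rw [comap_subtype_coe_apply Measure.isClosed_support.measurableSet, image_univ,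
      Subtype.range_coe]
    exact prob_compl_eq_zero_iff Measure.isClosed_support.measurableSet |>.1
      Measure.measure_compl_support⟩⟩

instance (μ : Pc n) : CompactSpace μ.meas.support :=
  isCompact_iff_compactSpace.1 μ.isCompact_support

instance (μ : Pc n) : Nonempty μ.meas.support :=
  (Measure.nonempty_support (IsProbabilityMeasure.ne_zero μ.meas)).to_subtype

/-- The inclusion of the support of `μ`. -/
noncomputable def suppIncl (μ : Pc n) : C(μ.meas.support, E n) := ⟨Subtype.val, by fun_prop⟩

lemma push_suppMeasure_meas (μ : Pc n) :
    (suppMeasure μ : Measure μ.meas.support).map Subtype.val = μ.meas := by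
  simp only [suppMeasure, ProbabilityMeasure.coe_mk]
  rw [map_comap_subtype_coe Measure.isClosed_support.measurableSet,
    Measure.restrict_eq_self_of_ae_mem μ.ae_mem_support]

lemma push_suppMeasure (μ : Pc n) : push (suppMeasure μ) (suppIncl μ) = μ :=
  Pc.ext_meas (push_suppMeasure_meas μ)

/-- Labelling by the support itself, and not by a larger compact set, keeps the initial sup norm
within `m_∞(μ₀)`, as the a priori bound requires. -/
lemma norm_suppIncl_le (μ : Pc n) : ‖suppIncl μ‖ ≤ mInf μ := by
  refine (ContinuousMap.norm_le_of_nonempty _).2 fun q => ?_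
  refine le_csSup ?_ ⟨q, q.2, rfl⟩
  exact (μ.isCompact_support.image continuous_norm).bddAbove

end Restrict

end Wasserstein

/-! ### Weak derivatives on an interval -/

section WeakDerivative

/-- A continuous function on `[0, T]` whose distributional derivative on `(0, T)` vanishes is
constant. -/
lemma exists_const_of_weak_deriv_eq_zero {T : ℝ} (hT : 0 < T) {H : ℝ → ℝ}
    (hH : ContinuousOn H (Icc 0 T))
    (h : ∀ η : ℝ → ℝ, ContDiff ℝ ∞ η → HasCompactSupport η → tsupport η ⊆ Ioo 0 T →
      ∫ t in (0 : ℝ)..T, deriv η t * H t = 0) :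
    ∃ c, ∀ t ∈ Icc 0 T, H t = c := by
  -- A smooth step from `0` on `t ≤ T / 4` to `1` on `t ≥ 3 * T / 4`. Its derivative has integral
  -- one and compact support in `(0, T)`; averaging `H` against it gives the constant `c`.
  set S : ℝ → ℝ := fun t => Real.smoothTransition ((t - T / 4) / (T / 2)) with hS
  have hSd : ContDiff ℝ ∞ S := Real.smoothTransition.contDiff.comp (by fun_prop)
  have hS0 : ∀ t ≤ T / 4, S t = 0 := fun t ht => Real.smoothTransition.zero_of_nonpos
    (div_nonpos_of_nonpos_of_nonneg (by linarith) (by positivity))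
  have hS1 : ∀ t, 3 * T / 4 ≤ t → S t = 1 := fun t ht => Real.smoothTransition.one_of_one_le
    ((one_le_div (by positivity)).2 (by linarith))
  have hSc : Continuous (deriv S) := hSd.continuous_deriv (by simp)
  have hHi : IntervalIntegrable H volume 0 T := by
    refine ContinuousOn.intervalIntegrable ?_
    rwa [uIcc_of_le hT.le]
  set c : ℝ := ∫ t in (0 : ℝ)..T, deriv S t * H t with hc
  have hloc : LocallyIntegrableOn (fun t => H t - c) (Ioo 0 T) volume :=
    ((hH.mono Ioo_subset_Icc_self).sub continuousOn_const).locallyIntegrableOn measurableSet_Ioo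
  have key := isOpen_Ioo.ae_eq_zero_of_integral_contDiff_smul_eq_zero hloc (fun ζ hζ hζc hζs => by
    obtain ⟨a, ha0, haT, ha⟩ : ∃ a, 0 < a ∧ a < T ∧ ∀ t ≤ a, ζ t = 0 := by
      rcases (tsupport ζ).eq_empty_or_nonempty with he | hne
      · refine ⟨T / 2, by positivity, by linarith, fun t _ => ?_⟩
        exact image_eq_zero_of_notMem_tsupport (by simp [he])
      · obtain ⟨p, hp, hpm⟩ := hζc.isCompact.exists_isLeast hne
        have := hζs hp
        refine ⟨p / 2, by linarith [this.1], by linarith [this.1, this.2], fun t ht => ?_⟩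
        refine image_eq_zero_of_notMem_tsupport fun hmem => ?_
        linarith [hpm hmem, this.1]
    obtain ⟨b, hb0, hbT, hb⟩ : ∃ b, 0 < b ∧ b < T ∧ ∀ t, b ≤ t → ζ t = 0 := by
      rcases (tsupport ζ).eq_empty_or_nonempty with he | hne
      · refine ⟨T / 2, by positivity, by linarith, fun t _ => ?_⟩
        exact image_eq_zero_of_notMem_tsupport (by simp [he])
      · obtain ⟨p, hp, hpm⟩ := hζc.isCompact.exists_isGreatest hne
        have := hζs hp
        refine ⟨(p + T) / 2, by linarith [this.1, this.2], by linarith [this.2], fun t ht => ?_⟩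
        refine image_eq_zero_of_notMem_tsupport fun hmem => ?_
        linarith [hpm hmem, this.2]
    set I : ℝ := ∫ t in (0 : ℝ)..T, ζ t with hI
    set Z : ℝ → ℝ := fun t => ∫ r in (0 : ℝ)..t, ζ r with hZ
    have hZd : ∀ t, HasDerivAt Z (ζ t) t := fun t =>
      intervalIntegral.integral_hasDerivAt_right (hζ.continuous.intervalIntegrable _ _)
        (hζ.continuous.stronglyMeasurableAtFilter _ _) hζ.continuous.continuousAt
    have hZs : ContDiff ℝ ∞ Z := by
      rw [contDiff_infty_iff_deriv]
      refine ⟨fun t => (hZd t).differentiableAt, ?_⟩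
      rwa [show deriv Z = ζ from funext fun t => (hZd t).deriv]
    have hZ0 : ∀ t ≤ a, Z t = 0 := by
      intro t ht
      refine intervalIntegral.integral_zero_ae (Eventually.of_forall fun r hr => ha r ?_)
      exact hr.2.trans (max_le ha0.le ht)
    have hZ1 : ∀ t, b ≤ t → Z t = I := by
      intro t ht
      rw [hZ, hI, ← sub_eq_zero]
      simp only
      rw [intervalIntegral.integral_interval_sub_left (hζ.continuous.intervalIntegrable _ _)
        (hζ.continuous.intervalIntegrable _ _)]
      refine intervalIntegral.integral_zero_ae (Eventually.of_forall fun r hr => hb r ?_)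
      exact (le_min hbT.le ht).trans hr.1.le
    -- Since `ζ - I * S'` has zero mean, its primitive `Z - I * S` vanishes near both ends and is
    -- admissible; testing with it yields `∫ ζ (H - c) = 0`.
    have hη : ContDiff ℝ ∞ (fun t => Z t - I * S t) := hZs.sub (contDiff_const.mul hSd)
    have hsub : tsupport (fun t => Z t - I * S t) ⊆ Icc (min a (T / 4)) (max b (3 * T / 4)) := by
      refine closure_minimal (fun t ht => ?_) isClosed_Icc
      by_contra hcon
      rw [mem_Icc, not_and_or, not_le, not_le] at hcon
      apply ht
      simp only
      rcases hcon with h1 | h1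
      · have := lt_min_iff.1 h1
        rw [hZ0 t this.1.le, hS0 t this.2.le]; simp
      · have := max_lt_iff.1 h1
        rw [hZ1 t this.1.le, hS1 t this.2.le]; simp
    have h0 := h _ hη (HasCompactSupport.of_support_subset_isCompact isCompact_Icc
      ((subset_tsupport _).trans hsub)) (hsub.trans fun t ht =>
        ⟨(lt_min ha0 (by positivity)).trans_le ht.1, ht.2.trans_lt (max_lt hbT (by linarith))⟩)
    have hder : ∀ t, deriv (fun t => Z t - I * S t) t = ζ t - I * deriv S t := fun t =>
      ((hZd t).sub (((hSd.differentiable (by simp)) t).hasDerivAt.const_mul I)).deriv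
    have hsupp : Function.support (fun t => ζ t • (H t - c)) ⊆ Ioc 0 T := fun t ht => by
      have : ζ t ≠ 0 := fun h0 => ht (by simp [h0])
      exact Ioo_subset_Ioc_self (hζs (subset_tsupport _ this))
    rw [← intervalIntegral.integral_eq_integral_of_support_subset hsupp]
    have i1 : IntervalIntegrable (fun t => ζ t * H t) volume 0 T :=
      hHi.continuousOn_mul hζ.continuous.continuousOn
    have i2 : IntervalIntegrable (fun t => deriv S t * H t) volume 0 T :=
      hHi.continuousOn_mul hSc.continuousOn
    have e1 : ∀ t, deriv (fun t => Z t - I * S t) t * H t =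
        ζ t * H t - I * (deriv S t * H t) := fun t => by rw [hder]; ring
    simp only [e1] at h0
    rw [intervalIntegral.integral_sub i1 (i2.const_mul _), intervalIntegral.integral_const_mul]
      at h0
    simp only [smul_eq_mul, mul_sub]
    rw [intervalIntegral.integral_sub i1 ((hζ.continuous.intervalIntegrable _ _).mul_const _),
      intervalIntegral.integral_mul_const]
    exact h0)
  refine ⟨c, fun t ht => ?_⟩
  refine Measure.eqOn_Icc_of_ae_eq (μ := volume) hT.ne ?_ hH continuousOn_const ht
  rw [← Measure.restrict_congr_set Ioo_ae_eq_Icc]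
  rw [Filter.EventuallyEq, ae_restrict_iff' measurableSet_Ioo]
  filter_upwards [key] with x hx hm
  exact sub_eq_zero.1 (hx hm)

/-- If `g` has the continuous distributional derivative `k` on `(0, T)`, then `g` is a primitive
of `k`. -/
lemma sub_eq_integral_of_weak_deriv {T : ℝ} (hT : 0 < T) {g k : ℝ → ℝ}
    (hg : ContinuousOn g (Icc 0 T)) (hk : ContinuousOn k (Icc 0 T))
    (h : ∀ η : ℝ → ℝ, ContDiff ℝ ∞ η → HasCompactSupport η → tsupport η ⊆ Ioo 0 T →
      ∫ t in (0 : ℝ)..T, (deriv η t * g t + η t * k t) = 0) :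
    ∀ s ∈ Icc 0 T, ∀ t ∈ Icc 0 T, g t - g s = ∫ r in s..t, k r := by
  set k' : ℝ → ℝ := fun t => k (projIcc 0 T hT.le t) with hk'
  have hk'c : Continuous k' :=
    (continuousOn_iff_continuous_domRestrict.1 hk).comp continuous_projIcc
  have hkk : ∀ t ∈ Icc 0 T, k' t = k t := fun t ht => by simp only [hk', projIcc_of_mem hT.le ht]
  set K : ℝ → ℝ := fun t => ∫ r in (0 : ℝ)..t, k' r with hK
  have hKd : ∀ t, HasDerivAt K (k' t) t := fun t =>
    intervalIntegral.integral_hasDerivAt_right (hk'c.intervalIntegrable _ _)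
      (hk'c.stronglyMeasurableAtFilter _ _) hk'c.continuousAt
  have hKc : Continuous K := continuous_iff_continuousAt.2 fun t => (hKd t).continuousAt
  have hu : uIcc 0 T = Icc 0 T := uIcc_of_le hT.le
  -- Integration by parts shows that `K` also has weak derivative `k`, so that of `g - K` vanishes.
  obtain ⟨c, hc⟩ := exists_const_of_weak_deriv_eq_zero hT (H := fun t => g t - K t)
    (hg.sub hKc.continuousOn) (fun η hη hηc hηs => by
      have hηd : ∀ t, HasDerivAt η (deriv η t) t := fun t =>
        (hη.differentiable (by simp) t).hasDerivAt
      have hη' : Continuous (deriv η) := hη.continuous_deriv (by simp)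
      have h1 := h η hη hηc hηs
      have h2 : ∫ t in (0 : ℝ)..T, (deriv η t * K t + η t * k' t) = η T * K T - η 0 * K 0 :=
        intervalIntegral.integral_eq_sub_of_hasDerivAt (fun t _ => (hηd t).mul (hKd t))
          ((hη'.mul hKc).add (hη.continuous.mul hk'c) |>.intervalIntegrable _ _)
      have hη0 : η 0 = 0 := image_eq_zero_of_notMem_tsupport fun hm => (hηs hm).1.false
      have hηT : η T = 0 := image_eq_zero_of_notMem_tsupport fun hm => (hηs hm).2.false
      rw [hη0, hηT, zero_mul, zero_mul, sub_zero] at h2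
      have h3 : ∫ t in (0 : ℝ)..T, ((deriv η t * g t + η t * k t) -
          (deriv η t * K t + η t * k' t)) = 0 := by
        rw [intervalIntegral.integral_sub, h1, h2, sub_zero]
        · refine ContinuousOn.intervalIntegrable ?_
          rw [hu]
          exact (hη'.continuousOn.mul hg).add (hη.continuous.continuousOn.mul hk)
        · exact ((hη'.mul hKc).add (hη.continuous.mul hk'c)).intervalIntegrable _ _
      refine Eq.trans ?_ h3
      refine intervalIntegral.integral_congr fun t ht => ?_
      rw [hu] at ht
      simp only [hkk t ht]
      ring)
  intro s hs t ht
  have h1 : ∫ r in s..t, k r = ∫ r in s..t, k' r :=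
    intervalIntegral.integral_congr fun r hr => (hkk r (uIcc_subset_Icc hs ht hr)).symm
  rw [h1, ← intervalIntegral.integral_interval_sub_left (a := 0) (hk'c.intervalIntegrable _ _)
    (hk'c.intervalIntegrable _ _)]
  have e1 := hc s hs
  have e2 := hc t ht
  simp only [hK] at e1 e2
  linarith

end WeakDerivative

/-! ### The linear continuity equation -/

section Transport

variable {n : ℕ}

/-- Time-dependent vector fields on `[0, T] × ℝⁿ`, Lipschitz in space and continuous in time,
uniformly in space. -/
structure IsTransportField (T L : ℝ) (v : ℝ → E n → E n) : Prop where
  lipschitz : ∀ t ∈ Icc 0 T, ∀ x y, ‖v t x - v t y‖ ≤ L * ‖x - y‖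
  continuous : ∀ s ∈ Icc 0 T, ∀ ε > 0, ∀ᶠ t in 𝓝[Icc 0 T] s, ∀ x, ‖v t x - v s x‖ ≤ ε

lemma IsTransportField.continuousOn {T L : ℝ} {v : ℝ → E n → E n} (hv : IsTransportField T L v) :
    ContinuousOn (Function.uncurry v) (Icc 0 T ×ˢ univ) := by
  rintro ⟨s, x⟩ ⟨hs, -⟩
  rw [Metric.continuousWithinAt_iff']
  intro ε hε
  have h1 : ∀ᶠ p : ℝ × E n in 𝓝[Icc 0 T ×ˢ univ] (s, x), ∀ x, ‖v p.1 x - v s x‖ ≤ ε / 2 := by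
    rw [nhdsWithin_prod_eq]
    exact tendsto_fst.eventually (hv.continuous s hs (ε / 2) (by positivity))
  have h2 : ∀ᶠ p : ℝ × E n in 𝓝[Icc 0 T ×ˢ univ] (s, x), L * ‖p.2 - x‖ < ε / 2 := by
    have : Tendsto (fun p : ℝ × E n => L * ‖p.2 - x‖) (𝓝 (s, x)) (𝓝 (L * ‖x - x‖)) :=
      Continuous.tendsto (f := fun p : ℝ × E n => L * ‖p.2 - x‖) (by fun_prop) (s, x)
    rw [sub_self, norm_zero, mul_zero] at this
    exact (this.mono_left nhdsWithin_le_nhds).eventually (gt_mem_nhds (by positivity))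
  filter_upwards [h1, h2, self_mem_nhdsWithin] with p hp1 hp2 hp
  simp only [Function.uncurry]
  rw [dist_eq_norm]
  calc ‖v p.1 p.2 - v s x‖ = ‖(v p.1 p.2 - v s p.2) + (v s p.2 - v s x)‖ := by congr 1; abel
    _ ≤ ‖v p.1 p.2 - v s p.2‖ + ‖v s p.2 - v s x‖ := norm_add_le _ _
    _ < ε := by linarith [hp1 p.2, hv.lipschitz s hs p.2 x]

/-- The weak form of the linear continuity equation with field `v`. -/
def WeakTransport (T : ℝ) (v : ℝ → E n → E n) (μ : ℝ → Pc n) : Prop :=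
  ∀ φ : ℝ × E n → ℝ, IsTestFunction T φ →
    ∫ t in (0 : ℝ)..T, ∫ x, (deriv (fun s => φ (s, x)) t +
      inner ℝ (gradient (fun z => φ (t, z)) x) (v t x)) ∂((μ t).meas) = 0

/-- Written as one Fréchet derivative in the direction `(1, v)`, the integrand is ready for the
chain rule along characteristics. -/
lemma deriv_add_inner_gradient {φ : ℝ × E n → ℝ} (hφ : Differentiable ℝ φ) (t : ℝ) (x v : E n) :
    deriv (fun s => φ (s, x)) t + inner ℝ (gradient (fun z => φ (t, z)) x) v =
      fderiv ℝ φ (t, x) (1, v) := by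
  have h1 : HasDerivAt (fun s => φ (s, x)) (fderiv ℝ φ (t, x) (1, 0)) t :=
    (hφ (t, x)).hasFDerivAt.comp_hasDerivAt t ((hasDerivAt_id t).prodMk (hasDerivAt_const t x))
  have h2 : HasFDerivAt (fun z => φ (t, z))
      ((fderiv ℝ φ (t, x)).comp (ContinuousLinearMap.inr ℝ ℝ (E n))) x :=
    (hφ (t, x)).hasFDerivAt.comp x (hasFDerivAt_prodMk_right t x)
  rw [h1.deriv, gradient, InnerProductSpace.toDual_symm_apply, h2.fderiv]
  simp only [ContinuousLinearMap.comp_apply, ContinuousLinearMap.inr_apply]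
  rw [← map_add]
  simp

/-- The integrated form of the continuity equation, tested with smooth functions of `(t, x)`. -/
def TransportIdentity (T : ℝ) (v : ℝ → E n → E n) (μ : ℝ → Pc n) : Prop :=
  ∀ ξ : ℝ × E n → ℝ, ContDiff ℝ ∞ ξ → ∀ s ∈ Icc 0 T, ∀ t ∈ Icc 0 T,
    ∫ x, ξ (t, x) ∂(μ t).meas - ∫ x, ξ (s, x) ∂(μ s).meas =
      ∫ r in s..t, ∫ x, fderiv ℝ ξ (r, x) (1, v r x) ∂(μ r).meas

lemma WeakTransport.transportIdentity {T L R : ℝ} (hT : 0 < T) (hR : 0 < R) {v : ℝ → E n → E n}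
    (hv : IsTransportField T L v) {μ : ℝ → Pc n} (hμ : IsContinuousCurve T μ)
    (hμR : ∀ t ∈ Icc 0 T, (μ t).meas.support ⊆ Metric.ball 0 R) (hw : WeakTransport T v μ) :
    TransportIdentity T v μ := by
  intro ξ hξ
  have hξ' : Continuous (fderiv ℝ ξ) := hξ.continuous_fderiv (by simp)
  have hkc : ContinuousOn (fun p : ℝ × E n => fderiv ℝ ξ p (1, v p.1 p.2)) (Icc 0 T ×ˢ univ) :=
    hξ'.continuousOn.clm_apply (continuousOn_const.prodMk hv.continuousOn)
  refine sub_eq_integral_of_weak_deriv hT (g := fun t => ∫ x, ξ (t, x) ∂(μ t).meas)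
    (k := fun r => ∫ x, fderiv ℝ ξ (r, x) (1, v r x) ∂(μ r).meas)
    (continuousOn_integral_curve hμ hμR hξ.continuous.continuousOn)
    (continuousOn_integral_curve hμ hμR hkc) (fun η hη hηc hηs => ?_)
  -- The cut-off makes `η ξ` a compactly supported test function. It equals one near every point of
  -- the supports of `μ t`, so it does not affect derivatives there.
  let χ : ContDiffBump (0 : E n) := ⟨R, R + 1, hR, by linarith⟩
  set φ : ℝ × E n → ℝ := fun p => η p.1 * (χ p.2 * ξ p) with hφ
  have hφd : ContDiff ℝ ∞ φ :=
    (hη.comp contDiff_fst).mul ((χ.contDiff.comp contDiff_snd).mul hξ)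
  have hsub : tsupport φ ⊆ tsupport η ×ˢ Metric.closedBall 0 (R + 1) := by
    refine closure_minimal (fun p hp => ⟨subset_tsupport _ fun h0 => hp ?_, ?_⟩)
      ((isClosed_tsupport _).prod Metric.isClosed_closedBall)
    · simp [hφ, h0]
    · have : p.2 ∈ Function.support χ := fun h0 => hp (by simp [hφ, h0])
      rw [χ.support_eq] at this
      exact Metric.ball_subset_closedBall this
  have htest : IsTestFunction T φ :=
    ⟨hφd, HasCompactSupport.of_support_subset_isCompact
      (hηc.isCompact.prod (isCompact_closedBall 0 (R + 1))) ((subset_tsupport _).trans hsub),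
      hsub.trans (prod_mono hηs (subset_univ _))⟩
  refine Eq.trans ?_ (hw φ htest)
  refine intervalIntegral.integral_congr fun t ht => ?_
  rw [uIcc_of_le hT.le] at ht
  simp only [deriv_add_inner_gradient (hφd.differentiable (by simp))]
  have hkt : Continuous fun x => fderiv ℝ ξ (t, x) (1, v t x) :=
    continuousOn_univ.1 (hkc.comp (by fun_prop) fun x _ => ⟨ht, mem_univ _⟩)
  have hgt : Continuous fun x => ξ (t, x) := hξ.continuous.comp (by fun_prop)
  rw [← integral_const_mul, ← integral_const_mul, ← integral_add
    (((μ t).integrable hgt).const_mul _) (((μ t).integrable hkt).const_mul _)]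
  refine integral_congr_ae ?_
  filter_upwards [(μ t).ae_mem_support] with x hx
  have hxR := hμR t ht hx
  have heq : φ =ᶠ[𝓝 (t, x)] fun p => η p.1 * ξ p := by
    have : ∀ᶠ p : ℝ × E n in 𝓝 (t, x), p.2 ∈ Metric.ball (0 : E n) R :=
      continuous_snd.continuousAt.eventually (Metric.isOpen_ball.mem_nhds hxR)
    filter_upwards [this] with p hp
    simp only [hφ]
    rw [χ.one_of_mem_closedBall (Metric.ball_subset_closedBall hp), one_mul]
  have hη1 : HasFDerivAt (fun p : ℝ × E n => η p.1)
      ((ContinuousLinearMap.toSpanSingleton ℝ (deriv η t)).comp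
        (ContinuousLinearMap.fst ℝ ℝ (E n))) (t, x) :=
    HasFDerivAt.comp (g := η) (t, x)
      (hη.differentiable (by simp) t).hasDerivAt.hasFDerivAt hasFDerivAt_fst
  have hm := hη1.mul (hξ.differentiable (by simp) (t, x)).hasFDerivAt
  have hm' : fderiv ℝ (fun p : ℝ × E n => η p.1 * ξ p) (t, x) = _ := hm.fderiv
  rw [heq.fderiv_eq, hm']
  simp
  ring

end Transport

/-! ### Smooth approximation of Lipschitz fields -/

section Mollification

variable {n : ℕ}

/-- Lipschitz vector fields are uniform limits of smooth fields with the same Lipschitz constant. -/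
lemma exists_contDiff_approx {v : E n → E n} {L : ℝ} (hL : 0 ≤ L)
    (hv : ∀ x y, ‖v x - v y‖ ≤ L * ‖x - y‖) {ε : ℝ} (hε : 0 < ε) :
    ∃ w : E n → E n, ContDiff ℝ ∞ w ∧ (∀ x, ‖fderiv ℝ w x‖ ≤ L) ∧ ∀ x, ‖w x - v x‖ ≤ ε := by
  have hlip : LipschitzWith L.toNNReal v := LipschitzWith.of_dist_le_mul fun x y => by
    rw [dist_eq_norm, dist_eq_norm, Real.coe_toNNReal _ hL]; exact hv x y
  -- A field of Lipschitz constant `L` varies by at most `L * δ ≤ ε` on balls of radius `δ`; the `+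
  -- 1` covers `L = 0`.
  set δ : ℝ := ε / (L + 1) with hδ
  have hδ0 : 0 < δ := by positivity
  let ρ : ContDiffBump (0 : E n) := ⟨δ / 2, δ, by positivity, by linarith⟩
  set w : E n → E n :=
    MeasureTheory.convolution (ρ.normed volume) v (ContinuousLinearMap.lsmul ℝ ℝ) volume with hw
  have hwd : ContDiff ℝ ∞ w :=
    ρ.hasCompactSupport_normed.contDiff_convolution_left _ ρ.contDiff_normed
      hlip.continuous.locallyIntegrable
  have hex : ∀ x, ConvolutionExistsAt (ρ.normed volume) v x (ContinuousLinearMap.lsmul ℝ ℝ)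
      volume := fun x => ρ.hasCompactSupport_normed.convolutionExists_left _
        ρ.continuous_normed hlip.continuous.locallyIntegrable x
  -- Averages of translates of `v` against a kernel of mass one keep the Lipschitz constant.
  have hwlip : LipschitzWith L.toNNReal w := by
    refine LipschitzWith.of_dist_le_mul fun x y => ?_
    rw [dist_eq_norm, dist_eq_norm, Real.coe_toNNReal _ hL]
    have e : w x - w y = ∫ t, (ρ.normed volume t • v (x - t) - ρ.normed volume t • v (y - t)) := by
      rw [integral_sub]
      · rfl
      · exact hex x
      · exact hex y
    rw [e]
    refine (norm_integral_le_of_norm_le (g := fun t => ρ.normed volume t * (L * ‖x - y‖))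
      (ρ.integrable_normed.mul_const _) (Eventually.of_forall fun t => ?_)).trans ?_
    · rw [← smul_sub, norm_smul, Real.norm_of_nonneg (ρ.nonneg_normed t)]
      refine mul_le_mul_of_nonneg_left ?_ (ρ.nonneg_normed t)
      simpa using hv (x - t) (y - t)
    · rw [integral_mul_const, ρ.integral_normed, one_mul]
  refine ⟨w, hwd, fun x => ?_, fun x => ?_⟩
  · have := norm_fderiv_le_of_lipschitz ℝ hwlip (x₀ := x)
    rwa [Real.coe_toNNReal _ hL] at this
  · rw [← dist_eq_norm]
    refine ρ.dist_normed_convolution_le hlip.continuous.aestronglyMeasurable fun y hy => ?_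
    rw [dist_eq_norm]
    refine (hv y x).trans ?_
    have h1 : ‖y - x‖ ≤ δ := by
      rw [← dist_eq_norm]; exact (Metric.mem_ball.1 hy).le
    calc L * ‖y - x‖ ≤ (L + 1) * δ := by gcongr; linarith
      _ = ε := by rw [hδ]; field_simp

end Mollification

/-! ### A Grönwall principle from infinitesimal steps -/

section LocalGronwall

/-- Because `κ` is arbitrary, the step inequality bounds the upper right Dini derivative of `f` by
`K * f`. -/
lemma nonpos_of_local_gronwall_right {a b K : ℝ} {f : ℝ → ℝ} (hf : ContinuousOn f (Icc a b))
    (h : ∀ s ∈ Icc a b, ∀ κ > 0, ∀ᶠ t in 𝓝[Icc a b] s,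
      f t ≤ (1 + K * |t - s|) * f s + κ * |t - s|) (h0 : f a ≤ 0) :
    ∀ t ∈ Icc a b, f t ≤ 0 := by
  intro t ht
  have := le_gronwallBound_of_liminf_deriv_right_le (f' := fun x => K * f x) (δ := 0) (K := K)
    (ε := 0) hf (fun x hx r hr => ?_) h0 (fun x _ => by simp) t ht
  · rwa [gronwallBound_ε0_δ0] at this
  refine Eventually.frequently ?_
  -- Half of the gap between `r` and `K * f x`, so that the difference quotient stays strictly below
  -- `r`.
  have h1 := h x ⟨hx.1, hx.2.le⟩ ((r - K * f x) / 2) (by linarith)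
  have h2 : 𝓝[>] x ≤ 𝓝[Icc a b] x := by
    rw [← nhdsWithin_Ioc_eq_nhdsGT hx.2]
    exact nhdsWithin_mono _ fun z hz => ⟨hx.1.trans hz.1.le, hz.2⟩
  filter_upwards [h2 h1, self_mem_nhdsWithin] with z hz hxz
  have hxz' : 0 < z - x := sub_pos.2 hxz
  rw [abs_of_pos hxz'] at hz
  rw [inv_mul_lt_iff₀ hxz']
  nlinarith

/-- A two-sided Grönwall principle with a local hypothesis. -/
lemma nonpos_of_local_gronwall {a b K : ℝ} {f : ℝ → ℝ} (hf : ContinuousOn f (Icc a b))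
    (h : ∀ s ∈ Icc a b, ∀ κ > 0, ∀ᶠ t in 𝓝[Icc a b] s,
      f t ≤ (1 + K * |t - s|) * f s + κ * |t - s|) {t₀ : ℝ} (ht₀ : t₀ ∈ Icc a b) (h0 : f t₀ ≤ 0) :
    ∀ t ∈ Icc a b, f t ≤ 0 := by
  intro t ht
  rcases le_total t₀ t with hle | hle
  · refine nonpos_of_local_gronwall_right (a := t₀) (b := b) (K := K)
      (hf.mono (Icc_subset_Icc_left ht₀.1)) (fun s hs κ hκ => ?_) h0 t ⟨hle, ht.2⟩
    exact nhdsWithin_mono _ (Icc_subset_Icc_left ht₀.1) (h s ⟨ht₀.1.trans hs.1, hs.2⟩ κ hκ)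
  · have hmap : MapsTo (fun s : ℝ => -s) (Icc (-t₀) (-a)) (Icc a b) := fun s hs =>
      ⟨by linarith [hs.2], by linarith [hs.1, ht₀.2]⟩
    have key := nonpos_of_local_gronwall_right (f := fun s => f (-s)) (a := -t₀) (b := -a) (K := K)
      (hf.comp continuous_neg.continuousOn hmap) (fun s hs κ hκ => ?_) (by simpa using h0)
      (-t) ⟨by linarith, by linarith [ht.1]⟩
    · simpa using key
    · have h1 : Tendsto (fun s : ℝ => -s) (𝓝[Icc (-t₀) (-a)] s) (𝓝[Icc a b] (-s)) :=
        continuous_neg.continuousWithinAt.tendsto_nhdsWithin hmap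
      filter_upwards [h1.eventually (h (-s) (hmap hs) κ hκ)] with t ht
      rwa [← neg_sub', abs_neg] at ht

end LocalGronwall

/-! ### Uniqueness for the linear continuity equation -/

section LinearUniqueness

variable {n : ℕ}

/-- Smooth functions with gradient at most one. -/
def smoothLip (n : ℕ) : Set (E n → ℝ) := {ψ | ContDiff ℝ ∞ ψ ∧ ∀ x, ‖fderiv ℝ ψ x‖ ≤ 1}

/-- The dual Lipschitz distance of two measures, computed with smooth functions. -/
noncomputable def dualDist (μ ν : Pc n) : ℝ :=
  ⨆ ψ : smoothLip n, (∫ x, ψ.1 x ∂μ.meas - ∫ x, ψ.1 x ∂ν.meas)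

lemma zero_mem_smoothLip : (fun _ => 0 : E n → ℝ) ∈ smoothLip n :=
  ⟨contDiff_const, fun x => by simp⟩

instance : Nonempty (smoothLip n) := ⟨⟨_, zero_mem_smoothLip⟩⟩

lemma smoothLip_abs_sub_le {ψ : E n → ℝ} (hψ : ψ ∈ smoothLip n) (x y : E n) :
    |ψ x - ψ y| ≤ ‖x - y‖ := by
  have := Convex.norm_image_sub_le_of_norm_fderiv_le (𝕜 := ℝ) (f := ψ) (C := 1) (s := univ)
    (fun x _ => hψ.1.differentiable (by simp) x) (fun x _ => hψ.2 x) convex_univ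
    (mem_univ y) (mem_univ x)
  simpa using this

/-- Subtracting `ψ 0`, which cancels between probability measures, leaves at most the sum of the
first moments. Without boundedness the real supremum would be `0` by convention. -/
lemma bddAbove_dualDist (μ ν : Pc n) : BddAbove (range fun ψ : smoothLip n =>
    (∫ x, ψ.1 x ∂μ.meas - ∫ x, ψ.1 x ∂ν.meas)) := by
  have key : ∀ (μ : Pc n) (ψ : smoothLip n),
      |∫ x, ψ.1 x ∂μ.meas - ψ.1 0| ≤ ∫ x, ‖x‖ ∂μ.meas := by
    intro μ ψ
    have e : ∫ x, ψ.1 x ∂μ.meas - ψ.1 0 = ∫ x, (ψ.1 x - ψ.1 0) ∂μ.meas := by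
      rw [integral_sub (μ.integrable ψ.2.1.continuous) (integrable_const _)]
      simp
    rw [e, ← Real.norm_eq_abs]
    refine norm_integral_le_of_norm_le (μ.integrable continuous_norm)
      (Eventually.of_forall fun x => ?_)
    simpa using smoothLip_abs_sub_le ψ.2 x 0
  refine ⟨∫ x, ‖x‖ ∂μ.meas + ∫ x, ‖x‖ ∂ν.meas, ?_⟩
  rintro _ ⟨ψ, rfl⟩
  have h1 := abs_le.1 (key μ ψ)
  have h2 := abs_le.1 (key ν ψ)
  simp only
  linarith [h1.2, h2.1]

lemma sub_le_dualDist (μ ν : Pc n) {ψ : E n → ℝ} {C : ℝ} (hC : 0 < C) (hψ : ContDiff ℝ ∞ ψ)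
    (hψC : ∀ x, ‖fderiv ℝ ψ x‖ ≤ C) :
    ∫ x, ψ x ∂μ.meas - ∫ x, ψ x ∂ν.meas ≤ C * dualDist μ ν := by
  have hmem : (fun x => C⁻¹ * ψ x) ∈ smoothLip n := by
    refine ⟨contDiff_const.mul hψ, fun x => ?_⟩
    rw [fderiv_const_mul (hψ.differentiable (by simp) x), norm_smul, norm_inv,
      Real.norm_of_nonneg hC.le, inv_mul_le_iff₀ hC]
    simpa using hψC x
  have h1 := le_ciSup (bddAbove_dualDist μ ν) ⟨_, hmem⟩
  simp only [integral_const_mul, ← mul_sub] at h1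
  rwa [inv_mul_le_iff₀ hC] at h1

/-- The functions `cos ⟨a, x⟩` and `sin ⟨a, x⟩` are smooth with bounded gradient, so the two
characteristic functions coincide. The bound `‖a‖ + 1` stays positive at `a = 0`. -/
lemma eq_of_dualDist_nonpos {μ ν : Pc n} (h : dualDist μ ν ≤ 0) : μ = ν := by
  have key : ∀ (ψ : E n → ℝ) (C : ℝ), 0 < C → ContDiff ℝ ∞ ψ → (∀ x, ‖fderiv ℝ ψ x‖ ≤ C) →
      ∫ x, ψ x ∂μ.meas = ∫ x, ψ x ∂ν.meas := by
    intro ψ C hC hψ hψC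
    have h1 := sub_le_dualDist μ ν hC hψ hψC
    have h2 := sub_le_dualDist μ ν (ψ := fun x => -ψ x) hC hψ.neg
      (fun x => by rw [fderiv_fun_neg, norm_neg]; exact hψC x)
    simp only [integral_neg] at h2
    have h3 : C * dualDist μ ν ≤ 0 := mul_nonpos_of_nonneg_of_nonpos hC.le h
    linarith
  refine Pc.ext_meas (Measure.ext_of_charFun (funext fun a => ?_))
  have hb : ∀ (r : ℝ), |r| ≤ 1 → ‖r • innerSL ℝ a‖ ≤ ‖a‖ + 1 := by
    intro r hr
    rw [norm_smul, innerSL_apply_norm, Real.norm_eq_abs]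
    nlinarith [norm_nonneg a, abs_nonneg r]
  have hin : ∀ x, HasFDerivAt (fun x : E n => inner ℝ a x) (innerSL ℝ a) x := fun x =>
    (innerSL ℝ a).hasFDerivAt
  have hcos := key (fun x => Real.cos (inner ℝ a x)) (‖a‖ + 1) (by positivity)
    (Real.contDiff_cos.comp (innerSL ℝ a).contDiff)
    (fun x => by
      rw [(hin x).cos.fderiv]
      exact hb _ (by rw [abs_neg]; exact Real.abs_sin_le_one _))
  have hsin := key (fun x => Real.sin (inner ℝ a x)) (‖a‖ + 1) (by positivity)
    (Real.contDiff_sin.comp (innerSL ℝ a).contDiff)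
    (fun x => by
      rw [(hin x).sin.fderiv]
      exact hb _ (Real.abs_cos_le_one _))
  have hsplit : ∀ ρ : Pc n, charFun ρ.meas a =
      ((∫ x, Real.cos (inner ℝ a x) ∂ρ.meas : ℝ) : ℂ) +
        ((∫ x, Real.sin (inner ℝ a x) ∂ρ.meas : ℝ) : ℂ) * Complex.I := by
    intro ρ
    have i1 : Integrable (fun x => ((Real.cos (inner ℝ a x) : ℝ) : ℂ)) ρ.meas :=
      ρ.integrable (by fun_prop)
    have i2 : Integrable (fun x => ((Real.sin (inner ℝ a x) : ℝ) : ℂ) * Complex.I) ρ.meas :=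
      ρ.integrable (by fun_prop)
    rw [charFun_apply, ← integral_complex_ofReal, ← integral_complex_ofReal,
      ← integral_mul_const, ← integral_add i1 i2]
    refine integral_congr_ae (Eventually.of_forall fun x => ?_)
    simp only [Complex.exp_mul_I, Complex.ofReal_cos, Complex.ofReal_sin, real_inner_comm a x]
  rw [hsplit, hsplit, hcos, hsin]

/-- One explicit Euler step: the dual Lipschitz distance of two solutions of the same continuity
equation at time `t` in terms of that at time `s`, for a smooth field `w` close to `v`. -/
lemma dualDist_step {T R M l e : ℝ} {v : ℝ → E n → E n} {μ ν : ℝ → Pc n}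
    (hμ : TransportIdentity T v μ) (hν : TransportIdentity T v ν)
    (hμR : ∀ t ∈ Icc 0 T, (μ t).meas.support ⊆ Metric.ball 0 R)
    (hνR : ∀ t ∈ Icc 0 T, (ν t).meas.support ⊆ Metric.ball 0 R)
    (hM : ∀ t ∈ Icc 0 T, ∀ x ∈ Metric.ball (0 : E n) R, ‖v t x‖ ≤ M)
    {w : E n → E n} (hw : ContDiff ℝ ∞ w) (hl : 0 ≤ l) (hwl : ∀ x, ‖fderiv ℝ w x‖ ≤ l)
    {s t : ℝ} (hs : s ∈ Icc 0 T) (ht : t ∈ Icc 0 T)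
    (he : ∀ r ∈ uIcc s t, ∀ x ∈ Metric.ball (0 : E n) R, ‖v r x - w x‖ ≤ e) :
    dualDist (μ t) (ν t) ≤
      (1 + l * |t - s|) * dualDist (μ s) (ν s) + 2 * (e + |t - s| * (l * M)) * |t - s| := by
  refine ciSup_le fun ⟨ψ, hψ⟩ => ?_
  -- Approximate backward transport of `ψ`: equal to `ψ` at time `t`, and of gradient at most `1 + l
  -- * |t - s|` at time `s`. Its derivative along `v` involves only `v - w` and a term of size `|t -
  -- s|`, because the leading terms cancel.
  set ξ : ℝ × E n → ℝ := fun p => ψ (p.2 + (t - p.1) • w p.2) with hξ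
  have hξd : ContDiff ℝ ∞ ξ := hψ.1.comp (by fun_prop)
  have hwd : ∀ x, HasFDerivAt w (fderiv ℝ w x) x := fun x =>
    (hw.differentiable (by simp) x).hasFDerivAt
  have hψd : ∀ x, HasFDerivAt ψ (fderiv ℝ ψ x) x := fun x =>
    (hψ.1.differentiable (by simp) x).hasFDerivAt
  have hder : ∀ r x, fderiv ℝ ξ (r, x) (1, v r x) =
      fderiv ℝ ψ (x + (t - r) • w x) (v r x - w x + (t - r) • fderiv ℝ w x (v r x)) := by
    intro r x
    have h1 : HasFDerivAt (fun p : ℝ × E n => t - p.1) (-ContinuousLinearMap.fst ℝ ℝ (E n))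
        (r, x) := hasFDerivAt_fst.const_sub t
    have h2 : HasFDerivAt (fun p : ℝ × E n => w p.2)
        ((fderiv ℝ w x).comp (ContinuousLinearMap.snd ℝ ℝ (E n))) (r, x) :=
      (hwd x).comp (r, x) hasFDerivAt_snd
    have h3 := (hψd (x + (t - r) • w x)).comp (r, x)
      ((hasFDerivAt_snd (𝕜 := ℝ) (p := (r, x))).add (h1.smul h2))
    have h4 : fderiv ℝ ξ (r, x) = _ := h3.fderiv
    rw [h4, ContinuousLinearMap.comp_apply]
    congr 1
    simp
    abel
  have hbound : ∀ ρ : ℝ → Pc n, (∀ t ∈ Icc 0 T, (ρ t).meas.support ⊆ Metric.ball 0 R) →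
      |∫ r in s..t, ∫ x, fderiv ℝ ξ (r, x) (1, v r x) ∂(ρ r).meas| ≤
        (e + |t - s| * (l * M)) * |t - s| := by
    intro ρ hρ
    rw [← Real.norm_eq_abs]
    refine intervalIntegral.norm_integral_le_of_norm_le_const fun r hr => ?_
    have hr' : r ∈ uIcc s t := uIoc_subset_uIcc hr
    have hrT : r ∈ Icc 0 T := uIcc_subset_Icc hs ht hr'
    refine (norm_integral_le_of_norm_le_const (C := e + |t - s| * (l * M)) ?_).trans
      (by simp)
    filter_upwards [(ρ r).ae_mem_support] with x hx
    have hxR := hρ r hrT hx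
    rw [hder]
    refine (ContinuousLinearMap.le_opNorm _ _).trans ?_
    refine (mul_le_of_le_one_left (norm_nonneg _) (hψ.2 _)).trans ?_
    refine (norm_add_le _ _).trans (add_le_add (he r hr' x hxR) ?_)
    rw [norm_smul, Real.norm_eq_abs]
    have h1 : |t - r| ≤ |t - s| := abs_sub_right_of_mem_uIcc hr'
    have h2 : ‖fderiv ℝ w x (v r x)‖ ≤ l * M :=
      (ContinuousLinearMap.le_opNorm _ _).trans
        (mul_le_mul (hwl x) (hM r hrT x hxR) (norm_nonneg _) hl)
    gcongr
  have e1 := hμ ξ hξd s hs t ht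
  have e2 := hν ξ hξd s hs t ht
  have b1 := abs_le.1 (hbound μ hμR)
  have b2 := abs_le.1 (hbound ν hνR)
  have hS := sub_le_dualDist (μ s) (ν s) (ψ := fun x => ξ (s, x)) (C := 1 + l * |t - s|)
    (by positivity) (hξd.comp (by fun_prop)) (fun x => by
      have h3 := (hψd (x + (t - s) • w x)).comp x ((hasFDerivAt_id x).add ((hwd x).const_smul (t - s)))
      have h4 : fderiv ℝ (fun x => ξ (s, x)) x = _ := h3.fderiv
      rw [h4]
      refine (ContinuousLinearMap.opNorm_comp_le _ _).trans ?_
      refine (mul_le_of_le_one_left (norm_nonneg _) (hψ.2 _)).trans ?_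
      refine (norm_add_le _ _).trans (add_le_add ContinuousLinearMap.norm_id_le ?_)
      rw [norm_smul, Real.norm_eq_abs, mul_comm]
      gcongr
      exact hwl x)
  have e3 : ∀ x, ξ (t, x) = ψ x := fun x => by simp [hξ]
  simp only [e3] at e1 e2
  simp only
  linarith [b1.1, b1.2, b2.1, b2.2]

/-- Uniqueness for the continuity equation of a Lipschitz field, among compactly supported
curves of measures, in both time directions. -/
lemma TransportIdentity.unique {T L R : ℝ} (hL : 0 ≤ L) {v : ℝ → E n → E n}
    (hv : IsTransportField T L v) {μ ν : ℝ → Pc n}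
    (hμ : TransportIdentity T v μ) (hν : TransportIdentity T v ν)
    (hμR : ∀ t ∈ Icc 0 T, (μ t).meas.support ⊆ Metric.ball 0 R)
    (hνR : ∀ t ∈ Icc 0 T, (ν t).meas.support ⊆ Metric.ball 0 R)
    {t₀ : ℝ} (ht₀ : t₀ ∈ Icc 0 T) (h0 : μ t₀ = ν t₀) :
    ∀ t ∈ Icc 0 T, μ t = ν t := by
  obtain ⟨M, hM'⟩ := (isCompact_Icc.prod (isCompact_closedBall (0 : E n) R)).exists_bound_of_continuousOn
    (hv.continuousOn.mono (prod_mono_right (subset_univ _)))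
  have hM : ∀ t ∈ Icc 0 T, ∀ x ∈ Metric.ball (0 : E n) R, ‖v t x‖ ≤ |M| := fun t ht x hx =>
    (hM' (t, x) ⟨ht, Metric.ball_subset_closedBall hx⟩).trans (le_abs_self M)
  have hlipW : ∀ s ∈ Icc 0 T, ∀ t ∈ Icc 0 T,
      dualDist (μ t) (ν t) ≤ dualDist (μ s) (ν s) + 2 * |M| * |t - s| := by
    intro s hs t ht
    -- The crude choice `w = 0` already shows that the distance is Lipschitz in time.
    have := dualDist_step (l := 0) (e := |M|) hμ hν hμR hνR hM (w := fun _ => 0) contDiff_const le_rfl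
      (by simp) hs ht (fun r hr x hx => by simpa using hM r (uIcc_subset_Icc hs ht hr) x hx)
    simpa using this
  have hcont : ContinuousOn (fun t => dualDist (μ t) (ν t)) (Icc 0 T) := by
    refine LipschitzOnWith.continuousOn (K := (2 * |M|).toNNReal)
      (LipschitzOnWith.of_dist_le_mul fun t ht s hs => ?_)
    rw [Real.coe_toNNReal _ (by positivity), Real.dist_eq, Real.dist_eq, abs_sub_le_iff]
    have h1 := hlipW s hs t ht
    have h2 := hlipW t ht s hs
    rw [abs_sub_comm s t] at h2
    constructor <;> linarith
  have hW0 : dualDist (μ t₀) (ν t₀) ≤ 0 := by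
    rw [h0]; exact ciSup_le fun ψ => by simp
  intro t ht
  refine eq_of_dualDist_nonpos (nonpos_of_local_gronwall (K := L) hcont
    (fun s hs κ hκ => ?_) ht₀ hW0 t ht)
  -- Mollification and variation in time each cost `κ / 8`, hence `e = κ / 4`; for `t` near `s` the
  -- second-order term is also at most `κ / 4`, and the total error is `κ * |t - s|`. The rate `L`
  -- does not depend on `κ`, since mollification preserves it.
  obtain ⟨w, hwd, hwL, hwv⟩ := exists_contDiff_approx hL (hv.lipschitz s hs)
    (ε := κ / 8) (by positivity)
  obtain ⟨δ, hδ, hδv⟩ := Metric.mem_nhdsWithin_iff.1 (hv.continuous s hs (κ / 8) (by positivity))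
  have hδ' : 0 < κ / (4 * (L * |M| + 1)) := by positivity
  filter_upwards [self_mem_nhdsWithin, mem_nhdsWithin_of_mem_nhds (Metric.ball_mem_nhds s hδ),
    mem_nhdsWithin_of_mem_nhds (Metric.ball_mem_nhds s hδ')] with t ht h1 h2
  rw [Metric.mem_ball, Real.dist_eq] at h1 h2
  have hstep := dualDist_step (e := κ / 4) hμ hν hμR hνR hM hwd hL hwL hs ht (fun r hr x _ => by
    have hr1 : |r - s| ≤ |t - s| := by
      rw [uIcc_comm] at hr
      rw [abs_sub_comm r s, abs_sub_comm t s]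
      exact abs_sub_right_of_mem_uIcc hr
    have h3 := hδv ⟨Metric.mem_ball.2 (by rw [Real.dist_eq]; exact hr1.trans_lt h1),
      uIcc_subset_Icc hs ht hr⟩ x
    have h4 := hwv x
    rw [norm_sub_rev] at h4
    calc ‖v r x - w x‖ = ‖(v r x - v s x) + (v s x - w x)‖ := by congr 1; abel
      _ ≤ ‖v r x - v s x‖ + ‖v s x - w x‖ := norm_add_le _ _
      _ ≤ κ / 4 := by linarith)
  refine hstep.trans ?_
  have h5 : |t - s| * (L * |M|) ≤ κ / 4 := by
    rw [lt_div_iff₀ (by positivity)] at h2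
    nlinarith [abs_nonneg (t - s)]
  have h6 : 2 * (κ / 4 + |t - s| * (L * |M|)) * |t - s| ≤ κ * |t - s| := by
    gcongr
    linarith
  linarith

end LinearUniqueness

/-! ### Characteristics and push-forward solutions -/

section Lagrangian

variable {n : ℕ} {Ω : Type*} [TopologicalSpace Ω] [CompactSpace Ω]

/-- Characteristics of a transport field starting from a continuous family of points. -/
lemma exists_characteristics {T L : ℝ} (hL : 0 < L) {v : ℝ → E n → E n}
    (hv : IsTransportField T L v) (hvc : ∀ t, Continuous (v t)) {t₀ : ℝ} (ht₀ : t₀ ∈ Icc 0 T)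
    (γ₀ : C(Ω, E n)) :
    ∃ γ : ℝ → C(Ω, E n), γ t₀ = γ₀ ∧
      ∀ t ∈ Icc 0 T, HasDerivWithinAt γ ((⟨v t, hvc t⟩ : C(E n, E n)).comp (γ t)) (Icc 0 T) t := by
  -- Solving in `C(Ω, ℝⁿ)` gives all characteristics at once, continuous in the label. Continuity in
  -- time of the composed field uses that `v` is continuous in time uniformly in space.
  refine ode_exists (f := fun t (γ : C(Ω, E n)) => (⟨v t, hvc t⟩ : C(E n, E n)).comp γ) hL
    (fun t ht γ γ' => ?_) (fun γ => ?_) ht₀ γ₀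
  · refine (ContinuousMap.norm_le _ (by positivity)).2 fun q => ?_
    refine (hv.lipschitz t ht (γ q) (γ' q)).trans ?_
    gcongr
    exact (γ - γ').norm_coe_le_norm q
  · intro s hs
    rw [Metric.continuousWithinAt_iff']
    intro ε hε
    filter_upwards [hv.continuous s hs (ε / 2) (by positivity)] with t ht
    rw [dist_eq_norm]
    refine lt_of_le_of_lt ((ContinuousMap.norm_le _ (by positivity)).2 fun q => ht (γ q)) ?_
    linarith

lemma hasDerivWithinAt_eval {s : Set ℝ} {γ : ℝ → C(Ω, E n)} {γ' : C(Ω, E n)} {t : ℝ}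
    (h : HasDerivWithinAt γ γ' s t) (q : Ω) :
    HasDerivWithinAt (fun t => γ t q) (γ' q) s t :=
  (ContinuousMap.evalCLM ℝ q : C(Ω, E n) →L[ℝ] E n).hasFDerivAt.comp_hasDerivWithinAt t h

variable [MeasurableSpace Ω] [BorelSpace Ω]

/-- Push-forwards along characteristics solve the continuity equation weakly. -/
lemma weakTransport_push {T L : ℝ} (hT : 0 < T) {v : ℝ → E n → E n} (hv : IsTransportField T L v)
    (m : ProbabilityMeasure Ω) {γ : ℝ → C(Ω, E n)} (hγc : ContinuousOn γ (Icc 0 T))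
    (hγ : ∀ q, ∀ t ∈ Icc 0 T, HasDerivWithinAt (fun t => γ t q) (v t (γ t q)) (Icc 0 T) t) :
    WeakTransport T v fun t => push m (γ t) := by
  rintro φ ⟨hφ, -, hφs⟩
  have hφd := hφ.differentiable (by simp)
  simp only [deriv_add_inner_gradient hφd]
  have hφ' : Continuous (fderiv ℝ φ) := hφ.continuous_fderiv (by simp)
  have hhc : ContinuousOn (fun p : ℝ × E n => fderiv ℝ φ p (1, v p.1 p.2)) (Icc 0 T ×ˢ univ) :=
    hφ'.continuousOn.clm_apply (continuousOn_const.prodMk hv.continuousOn)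
  have hγ2 : ContinuousOn (fun p : ℝ × Ω => (p.1, γ p.1 p.2)) (Icc 0 T ×ˢ univ) := by
    refine continuousOn_fst.prodMk ?_
    have h1 : ContinuousOn (fun p : ℝ × Ω => (γ p.1, p.2)) (Icc 0 T ×ˢ univ) :=
      (hγc.comp continuousOn_fst fun p hp => hp.1).prodMk continuousOn_snd
    exact (continuous_eval (F := C(Ω, E n))).comp_continuousOn h1
  set h : ℝ → Ω → ℝ := fun t q => fderiv ℝ φ (t, γ t q) (1, v t (γ t q)) with hh
  have hc : ContinuousOn (Function.uncurry h) (Icc 0 T ×ˢ univ) :=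
    hhc.comp hγ2 fun p hp => ⟨hp.1, mem_univ _⟩
  have e1 : ∀ t ∈ Icc 0 T, ∫ x, fderiv ℝ φ (t, x) (1, v t x) ∂(push m (γ t)).meas =
      ∫ q, h t q ∂(m : Measure Ω) := by
    intro t ht
    have hct : Continuous fun x => fderiv ℝ φ (t, x) (1, v t x) :=
      continuousOn_univ.1 (hhc.comp (by fun_prop) fun x _ => ⟨ht, mem_univ _⟩)
    rw [push_meas, integral_map (γ t).continuous.aemeasurable hct.aestronglyMeasurable]
  have e2 : ∫ t in (0 : ℝ)..T, ∫ x, fderiv ℝ φ (t, x) (1, v t x) ∂(push m (γ t)).meas =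
      ∫ t in (0 : ℝ)..T, ∫ q, h t q ∂(m : Measure Ω) := by
    refine intervalIntegral.integral_congr fun t ht => e1 t ?_
    rwa [uIcc_of_le hT.le] at ht
  have hint : Integrable (Function.uncurry h)
      ((volume.restrict (Ioc 0 T)).prod (m : Measure Ω)) := by
    have h1 : IntegrableOn (Function.uncurry h) (Icc 0 T ×ˢ univ)
        ((volume : Measure ℝ).prod (m : Measure Ω)) :=
      hc.integrableOn_compact' (isCompact_Icc.prod isCompact_univ)
        (measurableSet_Icc.prod MeasurableSet.univ)
    have h2 := h1.mono_set (prod_mono_left (t := univ) (Ioc_subset_Icc_self (a := 0) (b := T)))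
    rwa [IntegrableOn, ← Measure.prod_restrict, Measure.restrict_univ] at h2
  -- After Fubini, the integrand for each label `q` is the time derivative of `φ (t, γ t q)`, and
  -- `φ` vanishes at both end times.
  rw [e2, intervalIntegral.integral_of_le hT.le, integral_integral_swap hint]
  refine integral_eq_zero_of_ae (Eventually.of_forall fun q => ?_)
  simp only [Pi.zero_apply]
  rw [← intervalIntegral.integral_of_le hT.le]
  have hcq : ContinuousOn (fun t => h t q) (Icc 0 T) :=
    hc.comp (f := fun t => (t, q)) (by fun_prop) fun t ht => ⟨ht, mem_univ _⟩
  have hγq : ContinuousOn (fun t => γ t q) (Icc 0 T) := fun t ht =>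
    (hγ q t ht).continuousWithinAt
  rw [intervalIntegral.integral_eq_sub_of_hasDerivAt_of_le hT.le (f := fun t => φ (t, γ t q))
    (hφ.continuous.comp_continuousOn (continuousOn_id.prodMk hγq)) (fun t ht => ?_)
    (by apply ContinuousOn.intervalIntegrable; rwa [uIcc_of_le hT.le])]
  · rw [image_eq_zero_of_notMem_tsupport fun hm => (hφs hm).1.2.false,
      image_eq_zero_of_notMem_tsupport fun hm => (hφs hm).1.1.false, sub_zero]
  · have h1 := (hγ q t (Ioo_subset_Icc_self ht)).hasDerivAt (Icc_mem_nhds ht.1 ht.2)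
    exact (hφd (t, γ t q)).hasFDerivAt.comp_hasDerivAt t ((hasDerivAt_id t).prodMk h1)

end Lagrangian

/-! ### Global flow and null sets -/

section Flow

variable {n : ℕ}

/-- The `n`-dimensional Hausdorff measure of a preimage is controlled by the antilipschitz constant,
and this measure and Lebesgue measure are multiples of each other, both being Haar. -/
lemma volume_preimage_eq_zero_of_antilipschitz {K : NNReal} {f : E n → E n}
    (hf : AntilipschitzWith K f) {s : Set (E n)} (hs : volume s = 0) : volume (f ⁻¹' s) = 0 := by
  have hH : (Measure.hausdorffMeasure n : Measure (E n)).IsAddHaarMeasure := by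
    simpa using isAddHaarMeasure_hausdorffMeasure (E := E n)
  have h1 := Measure.isAddLeftInvariant_eq_smul (volume : Measure (E n))
    (Measure.hausdorffMeasure n)
  have h2 := Measure.isAddLeftInvariant_eq_smul (Measure.hausdorffMeasure n)
    (volume : Measure (E n))
  have h3 : (Measure.hausdorffMeasure n : Measure (E n)) s = 0 := by
    rw [h2, Measure.smul_apply, hs, smul_zero]
  have h4 : (Measure.hausdorffMeasure n : Measure (E n)) (f ⁻¹' s) = 0 := by
    refine le_antisymm ((hf.hausdorffMeasure_preimage_le (Nat.cast_nonneg n) s).trans ?_) zero_le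
    rw [h3, mul_zero]
  rw [h1, Measure.smul_apply, h4, smul_zero]

/-- A transport field has a flow of bi-Lipschitz maps. -/
lemma exists_flow {T L : ℝ} (hL : 0 < L) {v : ℝ → E n → E n} (hv : IsTransportField T L v)
    {t₀ : ℝ} (ht₀ : t₀ ∈ Icc 0 T) :
    ∃ Φ : ℝ → E n → E n, (∀ x, Φ t₀ x = x) ∧
      (∀ x, ∀ t ∈ Icc 0 T, HasDerivWithinAt (fun s => Φ s x) (v t (Φ t x)) (Icc 0 T) t) ∧
      ∀ t ∈ Icc 0 T, Continuous (Φ t) ∧ ∃ K, AntilipschitzWith K (Φ t) := by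
  choose Φ hΦ0 hΦ using fun x => ode_exists hL hv.lipschitz (fun x =>
    hv.continuousOn.comp (f := fun t => (t, x)) (by fun_prop) fun t ht => ⟨ht, mem_univ _⟩) ht₀ x
  refine ⟨fun t x => Φ x t, hΦ0, hΦ, fun t ht => ⟨?_, ?_⟩⟩
  · refine LipschitzWith.continuous (K := (Real.exp (L * |t - t₀|)).toNNReal)
      (LipschitzWith.of_dist_le_mul fun x y => ?_)
    have := ode_dist_le hv.lipschitz (hΦ x) (hΦ y) ht₀ t ht
    rw [hΦ0, hΦ0] at this
    rwa [dist_eq_norm, dist_eq_norm, Real.coe_toNNReal _ (Real.exp_pos _).le, mul_comm]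
  · refine ⟨(Real.exp (L * |t₀ - t|)).toNNReal, AntilipschitzWith.of_le_mul_dist fun x y => ?_⟩
    -- The same estimate run from `t` back to `t₀` bounds `‖x - y‖` by the distance of the images.
    have := ode_dist_le hv.lipschitz (hΦ x) (hΦ y) ht t₀ ht₀
    rw [hΦ0, hΦ0] at this
    rwa [dist_eq_norm, dist_eq_norm, Real.coe_toNNReal _ (Real.exp_pos _).le, mul_comm]

end Flow

/-! ### Primitives of controls -/

section Control

variable {c : ℕ}

lemma IsControl.intervalIntegrable {T : ℝ} {U : Set (E c)} {u : ℝ → E c} (hu : IsControl T U u)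
    {s t : ℝ} (hs : s ∈ Icc 0 T) (ht : t ∈ Icc 0 T) : IntervalIntegrable u volume s t := by
  have h1 : IntegrableOn u (Icc 0 T) volume := hu.1.integrable (by norm_num)
  exact (h1.mono_set (uIcc_subset_Icc hs ht)).intervalIntegrable

lemma IsControl.norm_integral_le {T M : ℝ} {U : Set (E c)} {u : ℝ → E c} (hu : IsControl T U u)
    (hM : ∀ a ∈ U, ‖a‖ ≤ M) {s t : ℝ} (hs : s ∈ Icc 0 T) (ht : t ∈ Icc 0 T) :
    ‖∫ r in s..t, u r‖ ≤ M * |t - s| := by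
  refine intervalIntegral.norm_integral_le_of_norm_le_const_ae ?_
  have h := (ae_restrict_iff' measurableSet_Icc).1 hu.2
  filter_upwards [h] with r hr hrs
  exact hM _ (hr (uIcc_subset_Icc hs ht (uIoc_subset_uIcc hrs)))

/-- Values in a bounded set make the primitive Lipschitz, hence continuous and absolutely
continuous, with a constant independent of `u`. -/
lemma IsControl.lipschitzOnWith {T M : ℝ} (hM0 : 0 ≤ M) {U : Set (E c)} {u : ℝ → E c}
    (hu : IsControl T U u) (hM : ∀ a ∈ U, ‖a‖ ≤ M) {t₀ : ℝ} (ht₀ : t₀ ∈ Icc 0 T) :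
    LipschitzOnWith M.toNNReal (fun t => ∫ r in t₀..t, u r) (Icc 0 T) := by
  refine LipschitzOnWith.of_dist_le_mul fun t ht s hs => ?_
  rw [dist_eq_norm, intervalIntegral.integral_interval_sub_left (hu.intervalIntegrable ht₀ ht)
    (hu.intervalIntegrable ht₀ hs), Real.coe_toNNReal _ hM0, Real.dist_eq]
  exact hu.norm_integral_le hM hs ht

lemma IsControl.ae_hasDerivAt {T : ℝ} {U : Set (E c)} {u : ℝ → E c} (hu : IsControl T U u)
    {t₀ : ℝ} (ht₀ : t₀ ∈ Icc 0 T) :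
    ∀ᵐ t ∂(volume.restrict (Icc 0 T)), HasDerivAt (fun t => ∫ r in t₀..t, u r) (u t) t := by
  have hT : (0 : ℝ) ≤ T := ht₀.1.trans ht₀.2
  have h := (hu.intervalIntegrable ⟨le_rfl, hT⟩ ⟨hT, le_rfl⟩).ae_hasDerivAt_integral
  rw [uIcc_of_le hT] at h
  rw [ae_restrict_iff' measurableSet_Icc]
  filter_upwards [h] with t ht hm
  exact ht hm t₀ ht₀

lemma ae_restrict_Icc_mem_Ioo (T : ℝ) :
    ∀ᵐ t ∂(volume.restrict (Icc 0 T)), t ∈ Ioo 0 T := by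
  rw [← Measure.restrict_congr_set Ioo_ae_eq_Icc]
  exact ae_restrict_mem measurableSet_Ioo

end Control

/-! ### The coupled system in Lagrangian form -/

section Coupled

variable {d c : ℕ} {F : Pc d → E d → E c → E d} {G : Pc d → E c → E c}

/-- Lipschitz continuity of the fields with constant `L`. -/
def LipWith (L : ℝ) (F : Pc d → E d → E c → E d) (G : Pc d → E c → E c) : Prop :=
  ∀ (μ₁ μ₂ : Pc d) (y₁ y₂ : E c),
    (∀ x₁ x₂ : E d, ‖F μ₁ x₁ y₁ - F μ₂ x₂ y₂‖ ≤ L * (‖x₁ - x₂‖ + dist𝔡 μ₁ y₁ μ₂ y₂)) ∧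
    ‖G μ₁ y₁ - G μ₂ y₂‖ ≤ L * dist𝔡 μ₁ y₁ μ₂ y₂

lemma LipWith.continuous_space {L : ℝ} (h : LipWith L F G) (μ : Pc d) (y : E c) :
    Continuous fun x => F μ x y := by
  refine LipschitzWith.continuous (K := L.toNNReal) (LipschitzWith.of_dist_le_mul fun x x' => ?_)
  have := (h μ μ y y).1 x x'
  rw [dist𝔡, W2_self, sub_self, norm_zero, add_zero, add_zero] at this
  rw [dist_eq_norm, dist_eq_norm]
  exact this.trans (mul_le_mul_of_nonneg_right (Real.le_coe_toNNReal L) (norm_nonneg _))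

lemma dist𝔡_tendsto {T : ℝ} {μ : ℝ → Pc d} {y : ℝ → E c} (hμ : IsContinuousCurve T μ)
    (hy : ContinuousOn y (Icc 0 T)) {s : ℝ} (hs : s ∈ Icc 0 T) (L : ℝ) :
    Tendsto (fun t => L * dist𝔡 (μ t) (y t) (μ s) (y s)) (𝓝[Icc 0 T] s) (𝓝 0) := by
  have h1 : Tendsto (fun t => ‖y t - y s‖) (𝓝[Icc 0 T] s) (𝓝 0) := by
    have := ((hy s hs).sub continuousWithinAt_const (g := fun _ => y s)).norm.tendsto
    simpa using this
  simpa [dist𝔡] using ((hμ s hs).add h1).const_mul L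

lemma LipWith.isTransportField {L T : ℝ} (h : LipWith L F G) {μ : ℝ → Pc d} {y : ℝ → E c}
    (hμ : IsContinuousCurve T μ) (hy : ContinuousOn y (Icc 0 T)) :
    IsTransportField T L fun t x => F (μ t) x (y t) := by
  refine ⟨fun t _ x x' => ?_, fun s hs ε hε => ?_⟩
  · have := (h (μ t) (μ t) (y t) (y t)).1 x x'
    rwa [dist𝔡, W2_self, sub_self, norm_zero, add_zero, add_zero] at this
  · filter_upwards [(dist𝔡_tendsto hμ hy hs L).eventually (gt_mem_nhds hε)] with t ht x
    have := (h (μ t) (μ s) (y t) (y s)).1 x x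
    rw [sub_self, norm_zero, zero_add] at this
    exact this.trans ht.le

lemma LipWith.continuousOn_G {L T : ℝ} (h : LipWith L F G) {μ : ℝ → Pc d} {y : ℝ → E c}
    (hμ : IsContinuousCurve T μ) (hy : ContinuousOn y (Icc 0 T)) :
    ContinuousOn (fun t => G (μ t) (y t)) (Icc 0 T) := by
  intro s hs
  rw [ContinuousWithinAt, tendsto_iff_norm_sub_tendsto_zero]
  exact squeeze_zero (fun _ => norm_nonneg _) (fun t => (h (μ t) (μ s) (y t) (y s)).2)
    (dist𝔡_tendsto hμ hy hs L)

variable {Ω : Type*} [TopologicalSpace Ω] [CompactSpace Ω] [MeasurableSpace Ω] [BorelSpace Ω]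

/-- The Lagrangian form of the coupled system: a field on `C(Ω, ℝᵈ) × ℝᶜ`, in which the control
enters through its primitive `w`. -/
noncomputable def lagrangianField (hF : ∀ μ y, Continuous fun x => F μ x y)
    (G : Pc d → E c → E c) (m : ProbabilityMeasure Ω) (w : ℝ → E c) (t : ℝ)
    (p : C(Ω, E d) × E c) : C(Ω, E d) × E c :=
  ((⟨fun x => F (push m p.1) x (p.2 + w t), hF _ _⟩ : C(E d, E d)).comp p.1,
    G (push m p.1) (p.2 + w t))

/-- The factor `3` counts position, measure and state. Taking `s = t` gives the Lipschitz bound in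
`p`, and `p = q` the continuity in time. -/
lemma LipWith.lagrangianField_lipschitz {L : ℝ} (hL : 0 < L) (h : LipWith L F G)
    (m : ProbabilityMeasure Ω) (w : ℝ → E c) (s t : ℝ) (p q : C(Ω, E d) × E c) :
    ‖lagrangianField h.continuous_space G m w t p - lagrangianField h.continuous_space G m w s q‖ ≤
      L * (3 * ‖p - q‖ + ‖w t - w s‖) := by
  have h1 : ‖p.1 - q.1‖ ≤ ‖p - q‖ := norm_fst_le (p - q)
  have h2 : ‖p.2 - q.2‖ ≤ ‖p - q‖ := norm_snd_le (p - q)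
  have h3 : dist𝔡 (push m p.1) (p.2 + w t) (push m q.1) (q.2 + w s) ≤
      2 * ‖p - q‖ + ‖w t - w s‖ := by
    have h4 := W2_push_le m p.1 q.1
    have h5 : ‖p.2 + w t - (q.2 + w s)‖ ≤ ‖p.2 - q.2‖ + ‖w t - w s‖ := by
      rw [add_sub_add_comm]; exact norm_add_le _ _
    rw [dist𝔡]
    linarith
  refine norm_prod_le_iff.2 ⟨?_, ?_⟩
  · refine (ContinuousMap.norm_le _ (by positivity)).2 fun x => ?_
    refine ((h _ _ _ _).1 (p.1 x) (q.1 x)).trans ?_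
    have h6 : ‖p.1 x - q.1 x‖ ≤ ‖p.1 - q.1‖ := (p.1 - q.1).norm_coe_le_norm x
    exact mul_le_mul_of_nonneg_left (by linarith) hL.le
  · refine ((h _ _ _ _).2).trans ?_
    exact mul_le_mul_of_nonneg_left (by linarith [norm_nonneg (p - q)]) hL.le

lemma LipWith.exists_lagrangian {L T : ℝ} (hL : 0 < L) (h : LipWith L F G)
    (m : ProbabilityMeasure Ω) {w : ℝ → E c} (hw : ContinuousOn w (Icc 0 T)) {t₀ : ℝ}
    (ht₀ : t₀ ∈ Icc 0 T) (p₀ : C(Ω, E d) × E c) :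
    ∃ p : ℝ → C(Ω, E d) × E c, p t₀ = p₀ ∧ ∀ t ∈ Icc 0 T,
      HasDerivWithinAt p (lagrangianField h.continuous_space G m w t (p t)) (Icc 0 T) t := by
  refine ode_exists (L := L * 3) (by positivity) (fun t _ p q => ?_) (fun p s hs => ?_) ht₀ p₀
  · have := h.lagrangianField_lipschitz hL m w t t p q
    rwa [sub_self, norm_zero, add_zero, ← mul_assoc] at this
  · rw [ContinuousWithinAt, tendsto_iff_norm_sub_tendsto_zero]
    refine squeeze_zero (fun _ => norm_nonneg _)
      (fun t => h.lagrangianField_lipschitz hL m w s t p p) ?_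
    have := (((hw s hs).sub continuousWithinAt_const (g := fun _ => w s)).norm.const_mul L).tendsto
    simpa using this

lemma LipWith.lagrangian_unique {L T : ℝ} (hL : 0 < L) (h : LipWith L F G)
    (m : ProbabilityMeasure Ω) {w : ℝ → E c} {t₀ : ℝ} (ht₀ : t₀ ∈ Icc 0 T)
    {p q : ℝ → C(Ω, E d) × E c} (h0 : p t₀ = q t₀)
    (hp : ∀ t ∈ Icc 0 T,
      HasDerivWithinAt p (lagrangianField h.continuous_space G m w t (p t)) (Icc 0 T) t)
    (hq : ∀ t ∈ Icc 0 T,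
      HasDerivWithinAt q (lagrangianField h.continuous_space G m w t (q t)) (Icc 0 T) t) :
    ∀ t ∈ Icc 0 T, p t = q t := by
  refine ode_unique (L := L * 3) (fun t _ p q => ?_) hp hq ht₀ h0
  have := h.lagrangianField_lipschitz hL m w t t p q
  rwa [sub_self, norm_zero, add_zero, ← mul_assoc] at this

lemma lagrangian_hasDerivWithinAt_apply (hF : ∀ μ y, Continuous fun x => F μ x y)
    {m : ProbabilityMeasure Ω} {w : ℝ → E c} {s : Set ℝ} {p : ℝ → C(Ω, E d) × E c} {t : ℝ}
    (hp : HasDerivWithinAt p (lagrangianField hF G m w t (p t)) s t) (x : Ω) :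
    HasDerivWithinAt (fun t => (p t).1 x)
      (F (push m (p t).1) ((p t).1 x) ((p t).2 + w t)) s t :=
  hasDerivWithinAt_eval ((hasFDerivAt_fst (𝕜 := ℝ) (p := p t)).comp_hasDerivWithinAt t hp) x

/-- Lagrangian solutions are solutions of the Cauchy problem. -/
lemma LipWith.isCauchySolution {L T M : ℝ} (hT : 0 < T) (h : LipWith L F G)
    (m : ProbabilityMeasure Ω) {U : Set (E c)} {u : ℝ → E c} (hu : IsControl T U u)
    (hM0 : 0 ≤ M) (hM : ∀ a ∈ U, ‖a‖ ≤ M) {t₀ : ℝ} (ht₀ : t₀ ∈ Icc 0 T)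
    {p : ℝ → C(Ω, E d) × E c}
    (hp : ∀ t ∈ Icc 0 T, HasDerivWithinAt p (lagrangianField h.continuous_space G m
      (fun t => ∫ r in t₀..t, u r) t (p t)) (Icc 0 T) t) :
    IsCauchySolution T F G t₀ (push m (p t₀).1) (p t₀).2 u (fun t => push m (p t).1)
      (fun t => (p t).2 + ∫ r in t₀..t, u r) := by
  have hpc : ContinuousOn p (Icc 0 T) := fun t ht => (hp t ht).continuousWithinAt
  have hγc : ContinuousOn (fun t => (p t).1) (Icc 0 T) := continuous_fst.comp_continuousOn hpc
  have hwl := hu.lipschitzOnWith hM0 hM ht₀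
  have hμ := isContinuousCurve_push m hγc
  have hyc : ContinuousOn (fun t => (p t).2 + ∫ r in t₀..t, u r) (Icc 0 T) :=
    (continuous_snd.comp_continuousOn hpc).add hwl.continuousOn
  have hz : ∀ t ∈ Icc 0 T, HasDerivWithinAt (fun t => (p t).2)
      (G (push m (p t).1) ((p t).2 + ∫ r in t₀..t, u r)) (Icc 0 T) t := fun t ht =>
    (hasFDerivAt_snd (𝕜 := ℝ) (p := p t)).comp_hasDerivWithinAt t (hp t ht)
  refine ⟨⟨hμ, equicompact_push m hγc, ?_, ?_, ?_⟩, rfl, by simp⟩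
  · exact weakTransport_push hT (h.isTransportField hμ hyc) m hγc fun x t ht =>
      lagrangian_hasDerivWithinAt_apply _ (hp t ht) x
  -- The state is the sum of two Lipschitz functions: one with bounded derivative and the primitive
  -- of the control.
  · obtain ⟨B, hB⟩ := isCompact_Icc.exists_bound_of_continuousOn (h.continuousOn_G hμ hyc)
    have hzl : LipschitzOnWith B.toNNReal (fun t => (p t).2) (Icc 0 T) :=
      (convex_Icc 0 T).lipschitzOnWith_of_nnnorm_hasDerivWithin_le hz fun t ht => by
        rw [← NNReal.coe_le_coe, coe_nnnorm]
        exact (hB t ht).trans (Real.le_coe_toNNReal B)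
    rw [← uIcc_of_le hT.le] at hzl hwl
    exact hzl.absolutelyContinuousOnInterval.add hwl.absolutelyContinuousOnInterval
  · filter_upwards [hu.ae_hasDerivAt ht₀, ae_restrict_Icc_mem_Ioo T] with t ht htm
    exact ((hz t (Ioo_subset_Icc_self htm)).hasDerivAt (Icc_mem_nhds htm.1 htm.2)).add ht

/-- The state component of a solution, up to the primitive of the control, is differentiable
everywhere. -/
lemma LipWith.state_hasDerivWithinAt {L T M : ℝ} (hT : 0 < T) (h : LipWith L F G)
    {U : Set (E c)} {u : ℝ → E c} (hu : IsControl T U u)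
    (hM0 : 0 ≤ M) (hM : ∀ a ∈ U, ‖a‖ ≤ M) {t₀ : ℝ} (ht₀ : t₀ ∈ Icc 0 T)
    {μ : ℝ → Pc d} {y : ℝ → E c} (hμ : IsContinuousCurve T μ)
    (hy : IsCaratheodorySolution T G u μ y) :
    ∀ t ∈ Icc 0 T, HasDerivWithinAt (fun t => y t - ∫ r in t₀..t, u r) (G (μ t) (y t))
      (Icc 0 T) t := by
  have hu' : uIcc 0 T = Icc 0 T := uIcc_of_le hT.le
  have hyc : ContinuousOn y (Icc 0 T) := by
    have := hy.1.continuousOn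
    rwa [hu'] at this
  have hGc := h.continuousOn_G hμ hyc
  set k : ℝ → E c := fun t => G (μ (projIcc 0 T hT.le t)) (y (projIcc 0 T hT.le t)) with hk
  have hkc : Continuous k :=
    (continuousOn_iff_continuous_domRestrict.1 hGc).comp continuous_projIcc
  have hkk : ∀ t ∈ Icc 0 T, k t = G (μ t) (y t) := fun t ht => by
    simp only [hk, projIcc_of_mem hT.le ht]
  set K : ℝ → E c := fun t => ∫ r in t₀..t, k r with hK
  have hKd : ∀ t, HasDerivAt K (k t) t := fun t =>
    intervalIntegral.integral_hasDerivAt_right (hkc.intervalIntegrable _ _)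
      (hkc.stronglyMeasurableAtFilter _ _) hkc.continuousAt
  have hKs : ContDiff ℝ 1 K := by
    rw [contDiff_one_iff_deriv]
    refine ⟨fun t => (hKd t).differentiableAt, ?_⟩
    rwa [show deriv K = k from funext fun t => (hKd t).deriv]
  have hwl := hu.lipschitzOnWith hM0 hM ht₀
  rw [← hu'] at hwl
  -- An absolutely continuous function with derivative zero almost everywhere is constant. Thus `y -
  -- w` differs by a constant from the `C¹` primitive `K`, and the almost everywhere equation holds
  -- everywhere.
  obtain ⟨a, ha⟩ := ((hy.1.sub hwl.absolutelyContinuousOnInterval).sub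
    hKs.contDiffOn.absolutelyContinuousOnInterval).const_of_ae_hasDerivAt_zero (by
      have h1 := (ae_restrict_iff' measurableSet_Icc).1 hy.2
      have h2 := (ae_restrict_iff' measurableSet_Icc).1 (hu.ae_hasDerivAt ht₀)
      filter_upwards [h1, h2] with t h1 h2 ht
      rw [hu'] at ht
      convert! ((h1 ht).sub (h2 ht)).sub (hKd t) using 1
      rw [hkk t ht]
      abel)
  intro t ht
  rw [← hkk t ht]
  refine ((hKd t).add_const a).hasDerivWithinAt.congr_of_mem (fun s hs => ?_) ht
  have := ha s (hu' ▸ hs)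
  simp only [Pi.sub_apply] at this
  rw [← this]
  abel

/-- Every solution of the Cauchy problem is Lagrangian. -/
lemma LipWith.exists_lagrangian_of_isCauchySolution {L T M : ℝ} (hT : 0 < T) (hL : 0 < L)
    (h : LipWith L F G) (m : ProbabilityMeasure Ω) {U : Set (E c)} {u : ℝ → E c}
    (hu : IsControl T U u) (hM0 : 0 ≤ M) (hM : ∀ a ∈ U, ‖a‖ ≤ M) {t₀ : ℝ} (ht₀ : t₀ ∈ Icc 0 T)
    {γ₀ : C(Ω, E d)} {y₀ : E c} {μ : ℝ → Pc d} {y : ℝ → E c}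
    (hsol : IsCauchySolution T F G t₀ (push m γ₀) y₀ u μ y) :
    ∃ p : ℝ → C(Ω, E d) × E c, p t₀ = (γ₀, y₀) ∧
      (∀ t ∈ Icc 0 T, HasDerivWithinAt p (lagrangianField h.continuous_space G m
        (fun t => ∫ r in t₀..t, u r) t (p t)) (Icc 0 T) t) ∧
      ∀ t ∈ Icc 0 T, μ t = push m (p t).1 ∧ y t = (p t).2 + ∫ r in t₀..t, u r := by
  obtain ⟨⟨hμ, ⟨R, hR, hμR⟩, hw, hy⟩, hμ0, hy0⟩ := hsol
  have hyc : ContinuousOn y (Icc 0 T) := by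
    have := hy.1.continuousOn
    rwa [uIcc_of_le hT.le] at this
  have hv := h.isTransportField hμ hyc
  obtain ⟨γ, hγ0, hγ⟩ := exists_characteristics hL hv (fun t => h.continuous_space _ _) ht₀ γ₀
  have hγc : ContinuousOn γ (Icc 0 T) := fun t ht => (hγ t ht).continuousWithinAt
  have hνc := isContinuousCurve_push m hγc
  obtain ⟨R', hR', hνR⟩ := equicompact_push m hγc
  have hνw := weakTransport_push hT hv m hγc fun x t ht => hasDerivWithinAt_eval (hγ t ht) x
  have hbμ : ∀ t ∈ Icc 0 T, (μ t).meas.support ⊆ Metric.ball 0 (max R R') := fun t ht =>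
    (hμR t ht).trans (Metric.ball_subset_ball (le_max_left _ _))
  have hbν : ∀ t ∈ Icc 0 T, (push m (γ t)).meas.support ⊆ Metric.ball 0 (max R R') := fun t ht =>
    (hνR t ht).trans (Metric.ball_subset_ball (le_max_right _ _))
  have hR0 : 0 < max R R' := hR.trans_le (le_max_left _ _)
  -- Here `v` is frozen along the given `(μ, y)`, so the comparison is linear. Once `μ` equals the
  -- push-forward, the frozen equation for `γ` is the coupled Lagrangian one.
  have heq := TransportIdentity.unique hL.le hv
    (WeakTransport.transportIdentity hT hR0 hv hμ hbμ hw)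
    (WeakTransport.transportIdentity hT hR0 hv hνc hbν hνw) hbμ hbν ht₀ (by rw [hμ0, hγ0])
  refine ⟨fun t => (γ t, y t - ∫ r in t₀..t, u r), by simp [hγ0, hy0], fun t ht => ?_,
    fun t ht => ⟨heq t ht, by simp⟩⟩
  have hz := h.state_hasDerivWithinAt hT hu hM0 hM ht₀ hμ hy t ht
  convert! (hγ t ht).prodMk hz using 1
  simp only [lagrangianField, sub_add_cancel, heq t ht]

/-- A priori bound for Lagrangian solutions. -/
lemma lagrangian_norm_le {C T M : ℝ} (hC : 0 < C) (hSLG : SLG C F G)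
    (hF : ∀ μ y, Continuous fun x => F μ x y) (m : ProbabilityMeasure Ω)
    {w : ℝ → E c} (hM0 : 0 ≤ M) (hw : ∀ t ∈ Icc 0 T, ‖w t‖ ≤ M) {t₀ : ℝ} (ht₀ : t₀ ∈ Icc 0 T)
    {p : ℝ → C(Ω, E d) × E c}
    (hp : ∀ t ∈ Icc 0 T, HasDerivWithinAt p (lagrangianField hF G m w t (p t)) (Icc 0 T) t)
    {R : ℝ} (hR : ‖p t₀‖ ≤ R) :
    ∀ t ∈ Icc 0 T, ‖p t‖ ≤ gronwallBound R (3 * C) (C * (1 + M)) T := by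
  intro t ht
  -- In the growth bound, `‖x‖`, the norm of the state without the control and `m_∞` are each at
  -- most `‖p t‖`, whence `3 * C`; the primitive of the control adds `C * M` to the constant term.
  have h1 := norm_le_gronwallBound_two_sided (K := 3 * C) (ε := C * (1 + M)) hp ht₀ hR
    (fun t ht => ?_) t ht
  · refine h1.trans (gronwallBound_mono ((norm_nonneg _).trans hR) (by positivity) (by positivity) ?_)
    rw [abs_le]
    constructor <;> linarith [ht.1, ht.2, ht₀.1, ht₀.2]
  · have a1 := norm_fst_le (p t)
    have a2 := norm_snd_le (p t)
    have a3 := mInf_push_le m (p t).1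
    have a4 : ‖(p t).2 + w t‖ ≤ ‖(p t).2‖ + M := (norm_add_le _ _).trans (by gcongr; exact hw t ht)
    have hs := hSLG (push m (p t).1) ((p t).2 + w t)
    have e : 3 * C * ‖p t‖ + C * (1 + M) = C * (3 * ‖p t‖ + (1 + M)) := by ring
    rw [e]
    refine norm_prod_le_iff.2 ⟨?_, ?_⟩
    · refine (ContinuousMap.norm_le _ (by positivity)).2 fun x => (hs.1 ((p t).1 x)).trans ?_
      have a5 := (p t).1.norm_coe_le_norm x
      exact mul_le_mul_of_nonneg_left (by linarith) hC.le
    · refine hs.2.trans ?_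
      exact mul_le_mul_of_nonneg_left (by linarith [norm_nonneg (p t)]) hC.le

end Coupled

/-! ### From labelled characteristics to the flow, and the theorem -/

section Main

variable {d c : ℕ} {F : Pc d → E d → E c → E d} {G : Pc d → E c → E c}

lemma exists_norm_bound {U : Set (E c)} (hU : IsCompact U) : ∃ M, 0 ≤ M ∧ ∀ a ∈ U, ‖a‖ ≤ M := by
  obtain ⟨M, hM⟩ := hU.isBounded.exists_norm_le
  exact ⟨|M|, abs_nonneg M, fun a ha => (hM a ha).trans (le_abs_self M)⟩

/-- The characteristics of a Lagrangian solution are restrictions of a global flow of bi-Lipschitz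
maps. -/
lemma LipWith.exists_isFlow {L T : ℝ} (hL : 0 < L) (h : LipWith L F G) {t₀ : ℝ}
    (ht₀ : t₀ ∈ Icc 0 T) {μ₀ : Pc d} {w : ℝ → E c} (hw : ContinuousOn w (Icc 0 T))
    {p : ℝ → C(μ₀.meas.support, E d) × E c} (hp0 : (p t₀).1 = suppIncl μ₀)
    (hp : ∀ t ∈ Icc 0 T, HasDerivWithinAt p
      (lagrangianField h.continuous_space G (suppMeasure μ₀) w t (p t)) (Icc 0 T) t) :
    ∃ Φ : ℝ → E d → E d,
      IsFlow T F t₀ (fun t => push (suppMeasure μ₀) (p t).1) (fun t => (p t).2 + w t) Φ ∧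
      ∀ t ∈ Icc 0 T, Continuous (Φ t) ∧ (∃ K, AntilipschitzWith K (Φ t)) ∧
        (push (suppMeasure μ₀) (p t).1).meas = μ₀.meas.map (Φ t) := by
  have hpc : ContinuousOn p (Icc 0 T) := fun t ht => (hp t ht).continuousWithinAt
  have hv := h.isTransportField
    (isContinuousCurve_push (suppMeasure μ₀) (continuous_fst.comp_continuousOn hpc))
    ((continuous_snd.comp_continuousOn hpc).add hw)
  obtain ⟨Φ, hΦ0, hΦ, hΦc⟩ := exists_flow hL hv ht₀
  refine ⟨Φ, ⟨hΦ0, hΦ⟩, fun t ht => ⟨(hΦc t ht).1, (hΦc t ht).2, ?_⟩⟩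
  -- On the support, the labelled curve and the global flow solve the same frozen equation from the
  -- same point.
  have heq : ∀ x : μ₀.meas.support, (p t).1 x = Φ t x := fun x =>
    ode_unique (f := fun t x => F (push (suppMeasure μ₀) (p t).1) x ((p t).2 + w t))
      (α := fun t => (p t).1 x) (β := fun t => Φ t x) hv.lipschitz
      (fun t ht => lagrangian_hasDerivWithinAt_apply _ (hp t ht) x) (hΦ x) ht₀
      (by rw [hp0, hΦ0]; rfl) t ht
  conv_rhs => rw [← push_suppMeasure_meas μ₀]
  rw [Measure.map_map (hΦc t ht).1.measurable measurable_subtype_coe, push_meas]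
  congr 1
  exact funext heq

end Main

end SparseMeanField

theorem mainTheorem5 (c : ℕ) (U : Set (SparseMeanField.E c)) (hU : IsCompact U)
    (hUconv : Convex ℝ U) (T : ℝ) (hT : 0 < T) (C : ℝ) (hC : 0 < C) :
    -- existence, uniqueness, Lagrangian representation, preservation of absolute continuity
    (∀ (d : ℕ)
      (F : SparseMeanField.Pc d → SparseMeanField.E d → SparseMeanField.E c → SparseMeanField.E d)
      (G : SparseMeanField.Pc d → SparseMeanField.E c → SparseMeanField.E c),
      SparseMeanField.LIP F G → SparseMeanField.SLG C F G →
      ∀ u : ℝ → SparseMeanField.E c, SparseMeanField.IsControl T U u →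
      ∀ t₀ ∈ Set.Icc 0 T, ∀ (μ₀ : SparseMeanField.Pc d) (y₀ : SparseMeanField.E c),
      ∃ (μ : ℝ → SparseMeanField.Pc d) (y : ℝ → SparseMeanField.E c),
        SparseMeanField.IsCauchySolution T F G t₀ μ₀ y₀ u μ y ∧
        (∀ (μ' : ℝ → SparseMeanField.Pc d) (y' : ℝ → SparseMeanField.E c),
          SparseMeanField.IsCauchySolution T F G t₀ μ₀ y₀ u μ' y' →
          ∀ t ∈ Set.Icc 0 T, μ' t = μ t ∧ y' t = y t) ∧
        (∃ Φ : ℝ → SparseMeanField.E d → SparseMeanField.E d,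
          SparseMeanField.IsFlow T F t₀ μ y Φ ∧
          ∀ t ∈ Set.Icc 0 T, Measurable (Φ t) ∧ (μ t).meas = μ₀.meas.map (Φ t)) ∧
        (μ₀.meas ≪ MeasureTheory.volume →
          ∀ t ∈ Set.Icc 0 T, (μ t).meas ≪ MeasureTheory.volume)) ∧
    -- a priori bounds, with a radius that depends only on `R`, `U`, `C` and `T`
    (∀ R : ℝ, 0 < R → ∃ Rbar : ℝ, 0 < Rbar ∧
      ∀ (d : ℕ)
      (F : SparseMeanField.Pc d → SparseMeanField.E d → SparseMeanField.E c → SparseMeanField.E d)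
      (G : SparseMeanField.Pc d → SparseMeanField.E c → SparseMeanField.E c),
      SparseMeanField.LIP F G → SparseMeanField.SLG C F G →
      ∀ u : ℝ → SparseMeanField.E c, SparseMeanField.IsControl T U u →
      ∀ t₀ ∈ Set.Icc 0 T, ∀ (μ₀ : SparseMeanField.Pc d) (y₀ : SparseMeanField.E c),
      SparseMeanField.mInf μ₀ ≤ R → ‖y₀‖ ≤ R →
      ∀ (μ : ℝ → SparseMeanField.Pc d) (y : ℝ → SparseMeanField.E c),
        SparseMeanField.IsCauchySolution T F G t₀ μ₀ y₀ u μ y →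
        ∀ t ∈ Set.Icc 0 T, SparseMeanField.mInf (μ t) ≤ Rbar ∧ ‖y t‖ ≤ Rbar) := by
  obtain ⟨M, hM0, hM⟩ := SparseMeanField.exists_norm_bound hU
  have hprim : ∀ {u : ℝ → SparseMeanField.E c}, SparseMeanField.IsControl T U u →
      ∀ {t₀ : ℝ}, t₀ ∈ Set.Icc 0 T → ∀ t ∈ Set.Icc 0 T, ‖∫ r in t₀..t, u r‖ ≤ M * T := by
    intro u hu t₀ ht₀ t ht
    refine (hu.norm_integral_le hM ht₀ ht).trans ?_
    have : |t - t₀| ≤ T := by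
      rw [abs_le]; constructor <;> linarith [ht.1, ht.2, ht₀.1, ht₀.2]
    gcongr
  refine ⟨fun d F G hLIP hSLG u hu t₀ ht₀ μ₀ y₀ => ?_, fun R hR => ?_⟩
  · obtain ⟨L, hL, h⟩ := hLIP
    replace h : SparseMeanField.LipWith L F G := h
    have hw := (hu.lipschitzOnWith hM0 hM ht₀).continuousOn
    set m := SparseMeanField.suppMeasure μ₀ with hm
    obtain ⟨p, hp0, hp⟩ := h.exists_lagrangian hL m hw ht₀ (SparseMeanField.suppIncl μ₀, y₀)
    have hsol := h.isCauchySolution hT m hu hM0 hM ht₀ hp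
    have hμ₀ : SparseMeanField.push m (p t₀).1 = μ₀ := by
      rw [hp0]; exact SparseMeanField.push_suppMeasure μ₀
    have hy₀ : (p t₀).2 = y₀ := by rw [hp0]
    rw [hμ₀, hy₀] at hsol
    obtain ⟨Φ, hΦ, hΦt⟩ := h.exists_isFlow hL ht₀ hw (by rw [hp0]) hp
    refine ⟨_, _, hsol, fun μ' y' hsol' t ht => ?_, ⟨Φ, hΦ, fun t ht =>
      ⟨(hΦt t ht).1.measurable, (hΦt t ht).2.2⟩⟩, fun hac t ht => ?_⟩
    -- Any competitor is Lagrangian with the same labels and initial value, so uniqueness for the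
    -- Banach space equation applies.
    · rw [← SparseMeanField.push_suppMeasure μ₀] at hsol'
      obtain ⟨q, hq0, hq, hqs⟩ := h.exists_lagrangian_of_isCauchySolution hT hL m hu hM0 hM ht₀ hsol'
      rw [(hqs t ht).1, (hqs t ht).2,
        h.lagrangian_unique hL m ht₀ (hq0.trans hp0.symm) hq hp t ht]
      exact ⟨rfl, rfl⟩
    · obtain ⟨hc, ⟨K, hK⟩, hmap⟩ := hΦt t ht
      rw [hmap]
      refine MeasureTheory.Measure.AbsolutelyContinuous.mk fun s hs hs0 => ?_
      rw [MeasureTheory.Measure.map_apply hc.measurable hs]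
      exact hac (SparseMeanField.volume_preimage_eq_zero_of_antilipschitz hK hs0)
  · have hB : R ≤ gronwallBound R (3 * C) (C * (1 + M * T)) T := by
      have := gronwallBound_mono (δ := R) (K := 3 * C) (ε := C * (1 + M * T)) hR.le
        (by positivity) (by positivity) hT.le
      rwa [gronwallBound_x0] at this
    have hMT : 0 ≤ M * T := by positivity
    -- `M * T` bounds the primitive of every control: it enters the Grönwall constant and is added
    -- once more to recover `y` from `y - w`. Neither `L` nor `d` occurs.
    refine ⟨gronwallBound R (3 * C) (C * (1 + M * T)) T + M * T, by linarith,
      fun d F G hLIP hSLG u hu t₀ ht₀ μ₀ y₀ hμR hyR μ y hsol t ht => ?_⟩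
    obtain ⟨L, hL, h⟩ := hLIP
    replace h : SparseMeanField.LipWith L F G := h
    rw [← SparseMeanField.push_suppMeasure μ₀] at hsol
    obtain ⟨p, hp0, hp, hps⟩ := h.exists_lagrangian_of_isCauchySolution hT hL
      (SparseMeanField.suppMeasure μ₀) hu hM0 hM ht₀ hsol
    have hpR : ‖p t₀‖ ≤ R := by
      rw [hp0]
      exact norm_prod_le_iff.2 ⟨(SparseMeanField.norm_suppIncl_le μ₀).trans hμR, hyR⟩
    have hb := SparseMeanField.lagrangian_norm_le hC hSLG h.continuous_space
      (SparseMeanField.suppMeasure μ₀) hMT (hprim hu ht₀) ht₀ hp hpR t ht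
    rw [(hps t ht).1, (hps t ht).2]
    refine ⟨(SparseMeanField.mInf_push_le _ _).trans ?_, (norm_add_le _ _).trans ?_⟩
    · linarith [norm_fst_le (p t)]
    · linarith [norm_snd_le (p t), hprim hu ht₀ t ht]
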